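/- Let $G$ be a countable group and let $\Sigma=\{\sigma_i:G\to\mathrm{Sym}(d_i)\}_{i\ge 1}$ be a sofic approximation sequence for $G$, i.e. $d_i\ge 1$ are integers with $d_i\to\infty$ (this is automatic if $G$ is infinite) and $\sigma_i$ are maps, not assumed to be homomorphisms, such that $\frac1{d_i}|\{k:\sigma_{i,st}(k)=\sigma_{i,s}\sigma_{i,t}(k)\}|\to 1$ for all $s,t\in G$ and $\frac1{d_i}|\{k:\sigma_{i,s}(k)\ne\sigma_{i,t}(k)\}|\to 1$ for all distinct $s,t\in G$. For a measure-preserving action of $G$ on a probability space $(X,\mathcal B,\mu)$, the sofic measure entropy is defined as follows. For a finite measurable partition $\alpha$ of $X$ and a finite set $F\subseteq G$ with $e\in F$, let $\alpha_F$ be the partition of $X$ consisting of the sets $\bigcap_{s\in F}sA_s$ with $A_s\in\alpha$, and let $\Sigma(\alpha_F)$ be the algebra it generates. Write $\mathcal P_d$ for the power set of $\{1,\dots,d\}$ and $\zeta$ for the uniform probability measure on $\{1,\dots,d\}$. For $\delta>0$ and $\sigma:G\to\mathrm{Sym}(d)$ let $\mathrm{Hom}_\mu(\alpha,F,\delta,\sigma)$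 be the set of all homomorphisms $\varphi:\Sigma(\alpha_F)\to\mathcal P_d$ of (unital) algebras of sets such that $\sum_{A\in\alpha}\frac1d|\sigma_s\varphi(A)\,\Delta\,\varphi(sA)|<\delta$ for all $s\in F$ and $\sum_{A\in\alpha_F}|\zeta(\varphi(A))-\mu(A)|<\delta$. For a partition $\xi$ that is refined by $\alpha$, let $|\mathrm{Hom}_\mu(\alpha,F,\delta,\sigma)|_\xi$ be the number of distinct restrictions to $\xi$ of elements of $\mathrm{Hom}_\mu(\alpha,F,\delta,\sigma)$. Then $$h_{\Sigma,\mu}(X,G)=\sup_{\xi}\ \inf_{\alpha\ge\xi}\ \inf_{F}\ \inf_{\delta>0}\ \limsup_{i\to\infty}\frac1{d_i}\log|\mathrm{Hom}_\mu(\alpha,F,\delta,\sigma_i)|_\xi\ \in[-\infty,\infty],$$ where $\log 0=-\infty$, $\xi$ ranges over the finite measurable partitions of $X$, $\alpha$ over the finite measurable partitions of $X$ that refine $\xi$, and $F$ over the finite subsets of $G$ containing $e$. For a probability space $(Y,\nu)$ let $H(\nu)\in[0,\infty]$ be the supremum of the Shannon entropies $H_\nu(\alpha)=-\sum_{A\in\alpha}\nu(A)\log\nu(A)$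 over all finite measurable partitions $\alpha$ of $Y$. **Theorem.** Let $(Y,\nu)$ be any probability space (not necessarily standard, and with $H(\nu)=\infty$ allowed), and let $G\curvearrowright(Y^G,\nu^G)$ be the associated Bernoulli action, that is, $(sx)_t=x_{s^{-1}t}$ on $Y^G$ with the product $\sigma$-algebra and the product measure. Then $$h_{\Sigma,\nu^G}(Y^G,G)=H(\nu).$$ -/

import Mathlib

open MeasureTheory Filter Topology
open scoped Pointwise symmDiff ENNReal

-- The left shift of `G` on `G → Y`, namely `(g • x) t = x (g⁻¹ * t)`.
attribute [local instance] arrowAction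

namespace SoficEntropy

/-- A sofic approximation sequence of the group `G`: positive integers `d i` and maps
`σ i : G → Sym (d i)` (not assumed to be homomorphisms) which are asymptotically multiplicative
and asymptotically free. -/
structure IsSoficApproximation {G : Type*} [Group G] (d : ℕ → ℕ)
    (σ : ∀ i, G → Equiv.Perm (Fin (d i))) : Prop where
  pos : ∀ i, 0 < d i
  mult : ∀ s t : G, Tendsto
    (fun i => ({k : Fin (d i) | σ i (s * t) k = σ i s (σ i t k)}.ncard : ℝ) / (d i : ℝ))
    atTop (𝓝 1)
  free : ∀ s t : G, s ≠ t → Tendsto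
    (fun i => ({k : Fin (d i) | σ i s k ≠ σ i t k}.ncard : ℝ) / (d i : ℝ)) atTop (𝓝 1)

/-- `α` is a finite partition of `X` (into nonempty sets) contained in the `σ`-algebra `S`. -/
def IsFinPartition {X : Type*} (S : MeasurableSpace X) (α : Finset (Set X)) : Prop :=
  Setoid.IsPartition (α : Set (Set X)) ∧ ∀ A ∈ α, MeasurableSet[S] A

/-- `α ≥ ξ` for partitions: every member of `α` lies in a member of `ξ`. -/
def Refines {X : Type*} (α ξ : Finset (Set X)) : Prop :=
  ∀ A ∈ α, ∃ B ∈ ξ, A ⊆ B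

open Classical in
/-- `α_F`, the family of all sets `⋂_{s ∈ F} s A_s` with `A ∈ α^F`. -/
noncomputable def translates {G X : Type*} [Group G] [MulAction G X]
    (α : Finset (Set X)) (F : Finset G) : Finset (Set X) :=
  (Fintype.piFinset (fun _ : F => α)).image (fun A => ⋂ s : F, (s : G) • A s)

/-- `Σ(α_F)`, the `σ`-algebra generated by `α_F` (a finite algebra of sets). -/
abbrev algebra {G X : Type*} [Group G] [MulAction G X]
    (α : Finset (Set X)) (F : Finset G) : MeasurableSpace X :=
  MeasurableSpace.generateFrom (translates α F : Set (Set X))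

/-- The translates `s A`, with `s ∈ F` and `A ∈ α`, belong to `Σ(α_F)`. -/
theorem measurableSet_smul {G X : Type*} [Group G] [MulAction G X]
    {α : Finset (Set X)} (hα : Setoid.IsPartition (α : Set (Set X))) {F : Finset G}
    {s : G} (hs : s ∈ F) {A : Set X} (hA : A ∈ α) :
    MeasurableSet[algebra α F] (s • A) := by
  classical
  have key : s • A = ⋃₀ {C | C ∈ translates α F ∧ C ⊆ s • A} := by
    apply Set.Subset.antisymm
    · intro x hx
      have hex : ∀ t : F, ∃ B ∈ α, (t : G)⁻¹ • x ∈ B := fun t => by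
        obtain ⟨B, ⟨hB, hxB⟩, -⟩ := hα.2 ((t : G)⁻¹ • x)
        exact ⟨B, by simpa using hB, hxB⟩
      choose B hB hxB using hex
      have hxs : s⁻¹ • x ∈ A := Set.mem_smul_set_iff_inv_smul_mem.1 hx
      have hBA : B ⟨s, hs⟩ = A :=
        (hα.2 (s⁻¹ • x)).unique ⟨by simpa using hB ⟨s, hs⟩, hxB ⟨s, hs⟩⟩ ⟨by simpa using hA, hxs⟩
      refine ⟨⋂ t : F, (t : G) • B t, ⟨?_, ?_⟩, ?_⟩
      · exact Finset.mem_image.2 ⟨B, by simpa using fun t ht => hB ⟨t, ht⟩, rfl⟩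
      · exact (Set.iInter_subset _ ⟨s, hs⟩).trans (by simp [hBA])
      · exact Set.mem_iInter.2 fun t => Set.mem_smul_set_iff_inv_smul_mem.2 (hxB t)
    · exact Set.sUnion_subset fun C hC => hC.2
  rw [key]
  refine @MeasurableSet.sUnion X (algebra α F) _ ?_ ?_
  · exact ((translates α F).finite_toSet.subset fun C hC => hC.1).countable
  · exact fun C hC => MeasurableSpace.measurableSet_generateFrom hC.1

/-- The Boolean algebra of sets that belong to the `σ`-algebra `m`. -/
abbrev Sets {X : Type*} (m : MeasurableSpace X) : Type _ := {A : Set X // MeasurableSet[m] A}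

/-- Homomorphisms of algebras of sets from `m` to the power set of `{1, …, d}`: they preserve
`∅`, the whole space, unions and intersections, hence complements. -/
abbrev AlgHom {X : Type*} (m : MeasurableSpace X) (d : ℕ) : Type _ :=
  BoundedLatticeHom (Sets m) (Set (Fin d))

open Classical in
/-- The value `φ(A)` of a homomorphism at a set `A` in its domain `m` (and `∅` for sets outside the
domain; it is never used there). -/
noncomputable def AlgHom.val {X : Type*} {m : MeasurableSpace X} {d : ℕ} (φ : AlgHom m d)
    (A : Set X) : Set (Fin d) :=
  if h : MeasurableSet[m] A then φ ⟨A, h⟩ else ∅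

/-- `Hom_μ(α, F, δ, σ)`, the set of all homomorphisms `φ : Σ(α_F) → 𝒫_d` with
`∑_{A ∈ α} |σ_s φ(A) Δ φ(sA)| / d < δ` for all `s ∈ F` and
`∑_{A ∈ α_F} |ζ(φ(A)) - μ(A)| < δ`. The sets `A ∈ α` lie in the domain `Σ(α_F)` when `1 ∈ F`;
this is the only case in which the definition is used. -/
def Hom {G X : Type*} [Group G] [MulAction G X] [MeasurableSpace X] (μ : Measure X)
    (α : Finset (Set X)) (F : Finset G) (δ : ℝ) {d : ℕ} (σ : G → Equiv.Perm (Fin d)) :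
    Set (AlgHom (algebra α F) d) :=
  {φ | (∀ s ∈ F, ∑ A ∈ α, (((σ s '' φ.val A) ∆ φ.val (s • A)).ncard : ℝ) / (d : ℝ) < δ) ∧
    ∑ A ∈ translates α F, |((φ.val A).ncard : ℝ) / (d : ℝ) - μ.real A| < δ}

/-- `|Hom_μ(α, F, δ, σ)|_ξ`, the number of restrictions to `ξ` of elements of
`Hom_μ(α, F, δ, σ)`. -/
noncomputable def homCard {G X : Type*} [Group G] [MulAction G X] [MeasurableSpace X]
    (μ : Measure X) (ξ α : Finset (Set X)) (F : Finset G) (δ : ℝ) {d : ℕ}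
    (σ : G → Equiv.Perm (Fin d)) : ℕ :=
  ((fun (φ : AlgHom (algebra α F) d) (B : ξ) => φ.val (B : Set X)) '' Hom μ α F δ σ).ncard

/-- `h_{Σ,μ}^ξ(α, F, δ) = limsup_i (1 / d_i) log |Hom_μ(α, F, δ, σ_i)|_ξ`, with `log 0 = -∞`. -/
noncomputable def entropyFδ {G X : Type*} [Group G] [MulAction G X] [MeasurableSpace X]
    (d : ℕ → ℕ) (σ : ∀ i, G → Equiv.Perm (Fin (d i))) (μ : Measure X)
    (ξ α : Finset (Set X)) (F : Finset G) (δ : ℝ) : EReal :=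
  limsup (fun i => ENNReal.log (homCard μ ξ α F δ (σ i) : ℝ≥0∞) / ((d i : ℝ) : EReal)) atTop

/-- `h_{Σ,μ}^ξ(α, F)`. -/
noncomputable def entropyF {G X : Type*} [Group G] [MulAction G X] [MeasurableSpace X]
    (d : ℕ → ℕ) (σ : ∀ i, G → Equiv.Perm (Fin (d i))) (μ : Measure X)
    (ξ α : Finset (Set X)) (F : Finset G) : EReal :=
  ⨅ (δ : ℝ) (_ : 0 < δ), entropyFδ d σ μ ξ α F δ

/-- `h_{Σ,μ}^ξ(α)`: the infimum over the finite sets `F ⊆ G` that contain the identity. -/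
noncomputable def entropyPartition {G X : Type*} [Group G] [MulAction G X] [MeasurableSpace X]
    (d : ℕ → ℕ) (σ : ∀ i, G → Equiv.Perm (Fin (d i))) (μ : Measure X)
    (ξ α : Finset (Set X)) : EReal :=
  ⨅ (F : Finset G) (_ : (1 : G) ∈ F), entropyF d σ μ ξ α F

/-- `h_{Σ,μ}^ξ(S)`: the infimum over the finite partitions `α ⊆ S` that refine `ξ`. -/
noncomputable def entropyInf {G X : Type*} [Group G] [MulAction G X]
    (S : MeasurableSpace X) [MeasurableSpace X] (d : ℕ → ℕ)
    (σ : ∀ i, G → Equiv.Perm (Fin (d i))) (μ : Measure X) (ξ : Finset (Set X)) : EReal :=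
  ⨅ (α : Finset (Set X)) (_ : IsFinPartition S α ∧ Refines α ξ), entropyPartition d σ μ ξ α

/-- `h_{Σ,μ}(S)`: the supremum over the finite partitions `ξ ⊆ S`. -/
noncomputable def entropyAlgebra {G X : Type*} [Group G] [MulAction G X]
    (S : MeasurableSpace X) [MeasurableSpace X] (d : ℕ → ℕ)
    (σ : ∀ i, G → Equiv.Perm (Fin (d i))) (μ : Measure X) : EReal :=
  ⨆ (ξ : Finset (Set X)) (_ : IsFinPartition S ξ), entropyInf S d σ μ ξ

/-- The sofic measure entropy `h_{Σ,μ}(X, G)`: the above for the full `σ`-algebra of `X`. -/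
noncomputable def soficEntropy {G X : Type*} [Group G] [MulAction G X] [mX : MeasurableSpace X]
    (d : ℕ → ℕ) (σ : ∀ i, G → Equiv.Perm (Fin (d i))) (μ : Measure X) : EReal :=
  entropyAlgebra mX d σ μ

/-- The Shannon entropy `H_ν(α) = -∑_{A ∈ α} ν(A) log ν(A)` of a finite partition. -/
noncomputable def shannonEntropy {Y : Type*} [MeasurableSpace Y] (ν : Measure Y)
    (α : Finset (Set Y)) : ℝ :=
  ∑ A ∈ α, Real.negMulLog (ν.real A)

/-- `H(ν)`, the supremum of `H_ν(α)` over the finite measurable partitions `α` of `Y`. -/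
noncomputable def baseEntropy {Y : Type*} [mY : MeasurableSpace Y] (ν : Measure Y) : EReal :=
  ⨆ (α : Finset (Set Y)) (_ : IsFinPartition mY α), (shannonEntropy ν α : EReal)

end SoficEntropy

/-! A homomorphism on the finite algebra `Σ(α_F)` amounts to choosing, for each index `k`, an atom,
hence a point `x k` of `Y^G` (`exists_points`). So `homCard_eq` turns the entropy into a count of
the traces on `ξ` of families of points that are almost equivariant along `σ` and have almost the
right atom frequencies. Both inequalities are proved for such families.

Upper bound. Each set of `ξ` is, up to measure `ε`, a cylinder depending on a finite window `E` of
coordinates, seen through a finite partition `η` of `Y`. Let `α` be the join of `ξ` with the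
pullback of `η` at the identity coordinate. Almost equivariance says that `x k t` usually lies in
the same cell of `η` as the identity coordinate of `x ((σ t)⁻¹ k)`. The word of cells at the
identity therefore predicts the trace on `ξ` outside a small set of indices (`ncard_prediction_le`).
A trace is coded by this word and one small error set per member of `ξ`. There are about `exp (d
H_ν(η))` words with the right frequencies (`ncard_words_le`) and subexponentially many corrections
(`ncard_small_sets_le`), so the rate is at most `H(ν)`.

Lower bound. Given `η`, let `ξ` be its pullback at the identity coordinate, and let `α`, `F`, `δ` be
arbitrary. Draw independent `ν`-distributed labels and read the points `x k` off them: coordinates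
in a large finite window are shared along `σ`, all others are fresh (`pick`). For most `k` the point
has law exactly `ν^G`, so arbitrary measurable sets can be handled by cylinder approximation, with
no structure on `Y`. Markov's inequality gives almost equivariance and Chebyshev's the frequencies,
so the family is admissible with probability at least `1/2` (`measure_not_pointMaps_le`). Each
admissible trace reveals a typical `η`-word, of probability about `exp (-d H_ν(η))`; hence there are
many traces (`exp_le_homCard`). -/

namespace SoficEntropy

/-! ### Homomorphisms of finite algebras as families of points -/

section Partitions

variable {G X : Type*} [Group G] [MulAction G X] {α ξ : Finset (Set X)} {F : Finset G}

theorem exists_cell (hα : Setoid.IsPartition (α : Set (Set X))) :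
    ∃ c : X → α, ∀ x, ∀ A : α, x ∈ (A : Set X) ↔ c x = A := by
  choose c hc hu using fun x => hα.2 x
  refine ⟨fun x => ⟨c x, by simpa using (hc x).1⟩, fun x A => ⟨fun h => ?_, ?_⟩⟩
  · exact Subtype.ext (hu x A ⟨by simp, h⟩).symm
  · rintro rfl
    exact (hc x).2

theorem eq_of_mem_partition (hα : Setoid.IsPartition (α : Set (Set X))) {A B : Set X}
    (hA : A ∈ α) (hB : B ∈ α) {x : X} (hxA : x ∈ A) (hxB : x ∈ B) : A = B :=
  (hα.2 x).unique ⟨by simpa using hA, hxA⟩ ⟨by simpa using hB, hxB⟩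

theorem mem_translates {C : Set X} :
    C ∈ translates α F ↔ ∃ A : F → Set X, (∀ s, A s ∈ α) ∧ ⋂ s : F, (s : G) • A s = C := by
  simp [translates, Fintype.mem_piFinset]

theorem exists_mem_translates (hα : Setoid.IsPartition (α : Set (Set X))) (F : Finset G) (x : X) :
    ∃ C ∈ translates α F, x ∈ C := by
  obtain ⟨c, hc⟩ := exists_cell hα
  refine ⟨_, mem_translates.2 ⟨fun s => c ((s : G)⁻¹ • x), fun s => (c _).2, rfl⟩, ?_⟩
  exact Set.mem_iInter.2 fun s => Set.mem_smul_set_iff_inv_smul_mem.2 ((hc _ _).2 rfl)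

theorem translates_smul_iff (hα : Setoid.IsPartition (α : Set (Set X))) {C : Set X}
    (hC : C ∈ translates α F) {x y : X} (hx : x ∈ C) (hy : y ∈ C) {s : G} (hs : s ∈ F)
    {A : Set X} (hA : A ∈ α) : s⁻¹ • x ∈ A ↔ s⁻¹ • y ∈ A := by
  obtain ⟨B, hB, rfl⟩ := mem_translates.1 hC
  have hx' := Set.mem_smul_set_iff_inv_smul_mem.1 (Set.mem_iInter.1 hx ⟨s, hs⟩)
  have hy' := Set.mem_smul_set_iff_inv_smul_mem.1 (Set.mem_iInter.1 hy ⟨s, hs⟩)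
  constructor
  · intro h
    rwa [eq_of_mem_partition hα hA (hB _) h hx']
  · intro h
    rwa [eq_of_mem_partition hα hA (hB _) h hy']

theorem translates_eq_of_mem (hα : Setoid.IsPartition (α : Set (Set X))) {C D : Set X}
    (hC : C ∈ translates α F) (hD : D ∈ translates α F) {x : X} (hx : x ∈ C) (hxD : x ∈ D) :
    C = D := by
  have key : ∀ {C D : Set X}, C ∈ translates α F → D ∈ translates α F → x ∈ C → x ∈ D →
      C ⊆ D := by
    intro C D hC hD hx hxD y hy
    obtain ⟨B, hB, rfl⟩ := mem_translates.1 hD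
    refine Set.mem_iInter.2 fun s => Set.mem_smul_set_iff_inv_smul_mem.2 ?_
    rw [← translates_smul_iff hα hC hx hy s.2 (hB s)]
    exact Set.mem_smul_set_iff_inv_smul_mem.1 (Set.mem_iInter.1 hxD s)
  exact (key hC hD hx hxD).antisymm (key hD hC hxD hx)

theorem mem_iff_of_measurableSet_algebra (hα : Setoid.IsPartition (α : Set (Set X)))
    {A : Set X} (hA : MeasurableSet[algebra α F] A) {C : Set X} (hC : C ∈ translates α F)
    {x y : X} (hx : x ∈ C) (hy : y ∈ C) : x ∈ A ↔ y ∈ A := by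
  induction A, hA using MeasurableSpace.generateFrom_induction with
  | hC D hD =>
    constructor
    · intro h
      rwa [← translates_eq_of_mem hα hC hD hx h]
    · intro h
      rwa [← translates_eq_of_mem hα hC hD hy h]
  | empty => simp
  | compl D _ ih => simp [ih]
  | iUnion D _ ih => simp [ih]

/-- The homomorphism of algebras of sets defined by a map into the space. -/
def pointHom (m : MeasurableSpace X) {d : ℕ} (x : Fin d → X) : AlgHom m d where
  toFun A := {k | x k ∈ A.1}
  map_sup' _ _ := rfl
  map_inf' _ _ := rfl
  map_top' := rfl
  map_bot' := rfl

theorem pointHom_val {m : MeasurableSpace X} {d : ℕ} (x : Fin d → X) {A : Set X}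
    (hA : MeasurableSet[m] A) : (pointHom m x).val A = {k | x k ∈ A} := by
  simp [AlgHom.val, hA, pointHom]

/-- The atoms in `α_F` join to the top, so every index `k` lies in the image of some atom. That atom
is nonempty because `φ` sends `∅` to `∅`, so a point can be chosen in it. A set of the algebra
contains or misses each atom, so the chosen point decides whether `k` lies in its image. -/
theorem exists_points (hα : Setoid.IsPartition (α : Set (Set X))) {d : ℕ}
    (φ : AlgHom (algebra α F) d) :
    ∃ x : Fin d → X, ∀ A, MeasurableSet[algebra α F] A → φ.val A = {k | x k ∈ A} := by
  have hm : ∀ C ∈ translates α F, MeasurableSet[algebra α F] C := fun C hC =>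
    MeasurableSpace.measurableSet_generateFrom hC
  have hex : ∀ k : Fin d, ∃ C : translates α F, k ∈ φ ⟨C, hm C C.2⟩ := by
    intro k
    have h1 : (Finset.univ.sup fun C : translates α F =>
        (⟨C, hm C C.2⟩ : Sets (algebra α F))) = ⊤ := by
      refine eq_top_iff.2 fun y _ => ?_
      obtain ⟨C, hC, hy⟩ := exists_mem_translates hα F y
      have h2 : (⟨C, hm C hC⟩ : Sets (algebra α F)) ≤ Finset.univ.sup fun C : translates α F =>
        (⟨C, hm C C.2⟩ : Sets (algebra α F)) :=
        Finset.le_sup (f := fun C : translates α F => (⟨C, hm C C.2⟩ : Sets (algebra α F)))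
          (Finset.mem_univ ⟨C, hC⟩)
      exact h2 hy
    have h3 := congrArg φ h1
    rw [map_finset_sup, TopHomClass.map_top] at h3
    have h4 : k ∈ (⊤ : Set (Fin d)) := trivial
    rw [← h3, Finset.sup_eq_iSup] at h4
    simpa using h4
  choose C hC using hex
  have hne : ∀ k, (C k : Set X).Nonempty := by
    intro k
    rw [Set.nonempty_iff_ne_empty]
    intro h
    have h1 : (⟨C k, hm _ (C k).2⟩ : Sets (algebra α F)) = ⊥ := Subtype.ext h
    have h2 := hC k
    rw [h1, BotHomClass.map_bot] at h2
    exact h2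
  choose x hx using hne
  refine ⟨x, fun A hA => ?_⟩
  ext k
  rw [AlgHom.val, dif_pos hA, Set.mem_ofPred_eq]
  constructor
  · intro hk
    by_contra hxA
    have h1 : (⟨A, hA⟩ : Sets (algebra α F)) ⊓ ⟨C k, hm _ (C k).2⟩ = ⊥ := by
      refine Subtype.ext (Set.eq_empty_of_forall_notMem fun y hy => hxA ?_)
      exact (mem_iff_of_measurableSet_algebra hα hA (C k).2 (hx k) hy.2).2 hy.1
    have h2 : k ∈ φ ⟨A, hA⟩ ⊓ φ ⟨C k, hm _ (C k).2⟩ := ⟨hk, hC k⟩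
    rw [← InfHomClass.map_inf, h1, BotHomClass.map_bot] at h2
    exact h2
  · intro hk
    have h1 : (⟨C k, hm _ (C k).2⟩ : Sets (algebra α F)) ≤ ⟨A, hA⟩ := fun y hy =>
      (mem_iff_of_measurableSet_algebra hα hA (C k).2 (hx k) hy).1 hk
    exact OrderHomClass.mono φ h1 (hC k)

/-- The maps `x` into the space whose homomorphism `A ↦ {k | x k ∈ A}` lies in `Hom`. -/
def pointMaps [MeasurableSpace X] (μ : Measure X)
    (α : Finset (Set X)) (F : Finset G) (δ : ℝ) {d : ℕ} (σ : G → Equiv.Perm (Fin d)) :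
    Set (Fin d → X) :=
  {x | (∀ s ∈ F, ∑ A ∈ α,
      ({k | ¬(x k ∈ A ↔ s⁻¹ • x (σ s k) ∈ A)}.ncard : ℝ) / (d : ℝ) < δ) ∧
    ∑ C ∈ translates α F, |({k | x k ∈ C}.ncard : ℝ) / (d : ℝ) - μ.real C| < δ}

theorem pointMaps_mono [MeasurableSpace X] {μ : Measure X} {δ δ' : ℝ} (h : δ ≤ δ') {d : ℕ}
    {σ : G → Equiv.Perm (Fin d)} : pointMaps μ α F δ σ ⊆ pointMaps μ α F δ' σ :=
  fun _ hx => ⟨fun s hs => (hx.1 s hs).trans_le h, hx.2.trans_le h⟩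

/-- Pulling the symmetric difference back along `e` turns the equivariance defect into a comparison
of `x k` with `s⁻¹ • x (e k)`. -/
theorem ncard_image_symmDiff {d : ℕ} (e : Equiv.Perm (Fin d)) (x : Fin d → X) (A : Set X) (s : G) :
    ((e '' {k | x k ∈ A}) ∆ {k | x k ∈ s • A}).ncard =
      {k | ¬(x k ∈ A ↔ s⁻¹ • x (e k) ∈ A)}.ncard := by
  rw [← Set.ncard_image_of_injective {k | ¬(x k ∈ A ↔ s⁻¹ • x (e k) ∈ A)} e.injective]
  congr 1
  ext k
  obtain ⟨j, rfl⟩ := e.surjective k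
  simp only [Set.mem_symmDiff, Set.mem_image, Set.mem_ofPred_eq, EmbeddingLike.apply_eq_iff_eq,
    exists_eq_right, Set.mem_smul_set_iff_inv_smul_mem]
  tauto

theorem mem_hom_iff [MeasurableSpace X] {μ : Measure X}
    (hα : Setoid.IsPartition (α : Set (Set X))) (hF : 1 ∈ F) {δ : ℝ} {d : ℕ}
    {σ : G → Equiv.Perm (Fin d)} {φ : AlgHom (algebra α F) d} {x : Fin d → X}
    (hx : ∀ A, MeasurableSet[algebra α F] A → φ.val A = {k | x k ∈ A}) :
    φ ∈ Hom μ α F δ σ ↔ x ∈ pointMaps μ α F δ σ := by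
  have h1 : ∀ A ∈ α, MeasurableSet[algebra α F] A := fun A hA => by
    simpa using measurableSet_smul hα hF hA
  have h2 : ∀ C ∈ translates α F, MeasurableSet[algebra α F] C := fun C hC =>
    MeasurableSpace.measurableSet_generateFrom hC
  refine and_congr (forall₂_congr fun s hs => ?_) ?_
  · rw [Finset.sum_congr rfl fun A hA => ?_]
    rw [hx A (h1 A hA), hx _ (measurableSet_smul hα hs hA), ncard_image_symmDiff]
  · rw [Finset.sum_congr rfl fun A hA => ?_]
    rw [hx A (h2 A hA)]

theorem mem_of_refines
    (hξ : Setoid.IsPartition (ξ : Set (Set X))) (h : Refines α ξ) {A B : Set X} (hA : A ∈ α)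
    (hB : B ∈ ξ) {x y : X} (hx : x ∈ A) (hy : y ∈ A) (hxB : x ∈ B) : y ∈ B := by
  obtain ⟨B', hB', hAB⟩ := h A hA
  rw [eq_of_mem_partition hξ hB hB' hxB (hAB hx)]
  exact hAB hy

theorem measurableSet_of_refines (hα : Setoid.IsPartition (α : Set (Set X)))
    (hξ : Setoid.IsPartition (ξ : Set (Set X))) (h : Refines α ξ) {m : MeasurableSpace X}
    (hm : ∀ A ∈ α, MeasurableSet[m] A) {B : Set X} (hB : B ∈ ξ) : MeasurableSet[m] B := by
  have key : B = ⋃₀ {A | A ∈ α ∧ A ⊆ B} := by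
    ext x
    constructor
    · intro hx
      obtain ⟨A, ⟨hA, hxA⟩, -⟩ := hα.2 x
      exact ⟨A, ⟨hA, fun y hy => mem_of_refines hξ h hA hB hxA hy hx⟩, hxA⟩
    · rintro ⟨A, ⟨-, hA⟩, hx⟩
      exact hA hx
  rw [key]
  exact MeasurableSet.sUnion (α.finite_toSet.subset fun A hA => hA.1).countable
    fun A hA => hm A hA.1

theorem homCard_eq [MeasurableSpace X] {μ : Measure X}
    (hα : Setoid.IsPartition (α : Set (Set X))) (hξ : Setoid.IsPartition (ξ : Set (Set X)))
    (h : Refines α ξ) (hF : 1 ∈ F) {δ : ℝ} {d : ℕ} {σ : G → Equiv.Perm (Fin d)} :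
    homCard μ ξ α F δ σ =
      ((fun (x : Fin d → X) (B : ξ) => {k | x k ∈ (B : Set X)}) '' pointMaps μ α F δ σ).ncard := by
  have hm : ∀ B : ξ, MeasurableSet[algebra α F] (B : Set X) := fun B =>
    measurableSet_of_refines hα hξ h (fun A hA => by simpa using measurableSet_smul hα hF hA) B.2
  unfold homCard
  congr 1
  ext r
  constructor
  · rintro ⟨φ, hφ, rfl⟩
    obtain ⟨x, hx⟩ := exists_points hα φ
    exact ⟨x, (mem_hom_iff hα hF hx).1 hφ, funext fun B => (hx B (hm B)).symm⟩
  · rintro ⟨x, hx, rfl⟩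
    exact ⟨pointHom _ x, (mem_hom_iff hα hF fun A hA => pointHom_val x hA).2 hx,
      funext fun B => pointHom_val x (hm B)⟩

theorem measurableSet_translates [MeasurableSpace X] [MeasurableConstSMul G X]
    (hα : ∀ A ∈ α, MeasurableSet A) {C : Set X} (hC : C ∈ translates α F) : MeasurableSet C := by
  obtain ⟨A, hA, rfl⟩ := mem_translates.1 hC
  exact MeasurableSet.iInter fun s => (hα _ (hA s)).const_smul _

/-- For a set `D` in the algebra `Σ(α_F)`, the frequency of visits to `D` is close to its
measure. -/
theorem abs_ncard_sub_lt [MeasurableSpace X] {μ : Measure X} [IsFiniteMeasure μ]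
    (hα : Setoid.IsPartition (α : Set (Set X))) (hF : ∀ C ∈ translates α F, MeasurableSet C)
    {δ : ℝ} {d : ℕ} {σ : G → Equiv.Perm (Fin d)} {x : Fin d → X} (hx : x ∈ pointMaps μ α F δ σ)
    {D : Set X} (hD : ∀ C ∈ translates α F, ∀ x ∈ C, ∀ y ∈ C, x ∈ D → y ∈ D) :
    |({k | x k ∈ D}.ncard : ℝ) / d - μ.real D| < δ := by
  classical
  set T := (translates α F).filter (· ⊆ D) with hT
  have hTt : ∀ C ∈ T, C ∈ translates α F := fun C hC => (Finset.mem_filter.1 hC).1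
  have hdis : (T : Set (Set X)).PairwiseDisjoint id := by
    intro C hC C' hC' hne
    refine Set.disjoint_left.2 fun y hy hy' => hne ?_
    exact translates_eq_of_mem hα (hTt C hC) (hTt C' hC') hy hy'
  have hDT : D = ⋃ C ∈ T, C := by
    ext y
    simp only [Set.mem_iUnion]
    constructor
    · intro hy
      obtain ⟨C, hC, hyC⟩ := exists_mem_translates hα F y
      exact ⟨C, Finset.mem_filter.2 ⟨hC, fun z hz => hD C hC y hyC z hz hy⟩, hyC⟩
    · rintro ⟨C, hC, hy⟩
      exact (Finset.mem_filter.1 hC).2 hy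
  have h1 : μ.real D = ∑ C ∈ T, μ.real C := by
    conv_lhs => rw [hDT]
    exact measureReal_biUnion_finset hdis fun C hC => hF C (hTt C hC)
  have h2 : ({k | x k ∈ D}.ncard : ℝ) = ∑ C ∈ T, ({k | x k ∈ C}.ncard : ℝ) := by
    have : {k | x k ∈ D}.toFinset = T.biUnion fun C => {k | x k ∈ C}.toFinset := by
      ext k
      simp only [Set.mem_toFinset, Set.mem_ofPred_eq, Finset.mem_biUnion]
      conv_lhs => rw [hDT]
      simp
    rw [Set.ncard_eq_toFinset_card', this, Finset.card_biUnion]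
    · push_cast
      exact Finset.sum_congr rfl fun C _ => by rw [Set.ncard_eq_toFinset_card']
    · intro C hC C' hC' hne
      refine Finset.disjoint_left.2 fun k hk hk' => ?_
      exact Set.disjoint_left.1 (hdis hC hC' hne) (by simpa using hk) (by simpa using hk')
  rw [h1, h2, Finset.sum_div, ← Finset.sum_sub_distrib]
  refine ((Finset.abs_sum_le_sum_abs _ _).trans ?_).trans_lt hx.2
  exact Finset.sum_le_sum_of_subset_of_nonneg (Finset.filter_subset _ _) fun _ _ _ => abs_nonneg _

end Partitions

/-! ### Counting words and small sets by weights -/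

section Counting

theorem sum_word {J : Type*} [Fintype J] {d : ℕ} (w : Fin d → J) (g : J → ℝ) :
    ∑ k, g (w k) = ∑ j, ({k | w k = j}.ncard : ℝ) * g j := by
  classical
  rw [← Finset.sum_fiberwise' Finset.univ w g]
  refine Finset.sum_congr rfl fun j _ => ?_
  rw [Finset.sum_const, nsmul_eq_mul, Set.ncard_eq_toFinset_card']
  congr 3
  ext k
  simp

/-- Under the product weight of `q` all words have total mass one, and the frequency bound forces
each word of `W` to have mass at least the inverse of the right-hand side. Keeping `q` apart from
`p` allows `q` to be positive where `p` vanishes. -/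
theorem ncard_words_le {J : Type*} [Fintype J] {d : ℕ} {W : Set (Fin d → J)} {p q : J → ℝ} {δ : ℝ}
    (hq : ∀ j, 0 < q j) (hq1 : ∑ j, q j = 1)
    (hW : ∀ w ∈ W, ∀ j, ({k | w k = j}.ncard : ℝ) ≤ d * (p j + δ)) :
    (W.ncard : ℝ) ≤ Real.exp (d * ∑ j, (p j + δ) * -Real.log (q j)) := by
  classical
  have hle : ∀ j, q j ≤ 1 := fun j => by
    rw [← hq1]
    exact Finset.single_le_sum (fun i _ => (hq i).le) (Finset.mem_univ j)
  set c := Real.exp (-(d * ∑ j, (p j + δ) * -Real.log (q j))) with hc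
  have h1 : ∀ w ∈ W.toFinset, c ≤ ∏ k, q (w k) := by
    intro w hw
    have hw' : w ∈ W := by simpa using hw
    have h2 : ∏ k, q (w k) = Real.exp (∑ k, Real.log (q (w k))) := by
      rw [Real.exp_sum]
      exact Finset.prod_congr rfl fun k _ => (Real.exp_log (hq _)).symm
    rw [h2, sum_word w fun j => Real.log (q j), hc, Real.exp_le_exp, Finset.mul_sum,
      ← Finset.sum_neg_distrib]
    refine Finset.sum_le_sum fun j _ => ?_
    have h3 := hW w hw' j
    have h4 : 0 ≤ -Real.log (q j) := by
      linarith [Real.log_nonpos (hq j).le (hle j)]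
    have h5 := mul_le_mul_of_nonneg_right h3 h4
    linarith
  have h2 : (W.ncard : ℝ) * c ≤ 1 := by
    calc (W.ncard : ℝ) * c = ∑ w ∈ W.toFinset, c := by
          rw [Finset.sum_const, nsmul_eq_mul, Set.ncard_eq_toFinset_card']
      _ ≤ ∑ w ∈ W.toFinset, ∏ k, q (w k) := Finset.sum_le_sum h1
      _ ≤ ∑ w : Fin d → J, ∏ k, q (w k) := by
          refine Finset.sum_le_sum_of_subset_of_nonneg (Finset.subset_univ _) fun w _ _ => ?_
          exact Finset.prod_nonneg fun k _ => (hq _).le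
      _ = 1 := by rw [← Fintype.sum_pow, hq1, one_pow]
  rw [hc, Real.exp_neg] at h2
  rwa [← div_eq_mul_inv, div_le_one (Real.exp_pos _)] at h2

/-- Give a set `S` the weight `θ ^ |S|`: the total is `(1 + θ) ^ d`, and each counted set weighs at
least `θ ^ r`. -/
theorem ncard_small_sets_le {d : ℕ} {r θ : ℝ} (h0 : 0 < θ) (h1 : θ ≤ 1) :
    ({S : Set (Fin d) | (S.ncard : ℝ) ≤ r}.ncard : ℝ) ≤
      Real.exp (d * Real.log (1 + θ) - r * Real.log θ) := by
  classical
  have him : {S : Set (Fin d) | (S.ncard : ℝ) ≤ r} =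
      (fun s : Finset (Fin d) => (s : Set (Fin d))) ''
        {s : Finset (Fin d) | (s.card : ℝ) ≤ r} := by
    ext S
    constructor
    · intro hS
      refine ⟨S.toFinset, ?_, by simp⟩
      simpa [Set.ncard_eq_toFinset_card'] using hS
    · rintro ⟨s, hs, rfl⟩
      simpa using hs
  rw [him, Set.ncard_image_of_injective _ Finset.coe_injective, Set.ncard_eq_toFinset_card']
  set W := {s : Finset (Fin d) | (s.card : ℝ) ≤ r}.toFinset with hW
  have h2 : (W.card : ℝ) * Real.exp (r * Real.log θ) ≤ Real.exp (d * Real.log (1 + θ)) := by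
    calc (W.card : ℝ) * Real.exp (r * Real.log θ)
        = ∑ s ∈ W, Real.exp (r * Real.log θ) := by rw [Finset.sum_const, nsmul_eq_mul]
      _ ≤ ∑ s ∈ W, θ ^ s.card := by
          refine Finset.sum_le_sum fun s hs => ?_
          have hs' : (s.card : ℝ) ≤ r := by simpa [hW] using hs
          rw [← Real.exp_log (pow_pos h0 s.card), Real.exp_le_exp, Real.log_pow]
          exact mul_le_mul_of_nonpos_right hs' (Real.log_nonpos h0.le h1)
      _ ≤ ∑ s : Finset (Fin d), θ ^ s.card :=
          Finset.sum_le_sum_of_subset_of_nonneg (Finset.subset_univ _)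
            fun s _ _ => pow_nonneg h0.le _
      _ = (1 + θ) ^ d := by
          have := Fintype.sum_pow_mul_eq_add_pow (Fin d) θ 1
          simpa [add_comm] using this
      _ = Real.exp (d * Real.log (1 + θ)) := by
          rw [← Real.log_pow, Real.exp_log (by positivity)]
  rwa [Real.exp_sub, le_div_iff₀ (Real.exp_pos _)]

end Counting

/-! ### From bounds at each index to exponential rates -/

section Limits

variable {G X : Type*} [Group G] [MulAction G X] [MeasurableSpace X] {μ : Measure X}
  {ξ α : Finset (Set X)} {F : Finset G} {δ : ℝ} {d : ℕ → ℕ} {σ : ∀ i, G → Equiv.Perm (Fin (d i))}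

theorem entropyFδ_le (hd : ∀ i, 0 < d i) {c : ℝ}
    (h : ∀ i, (homCard μ ξ α F δ (σ i) : ℝ) ≤ Real.exp (d i * c)) :
    entropyFδ d σ μ ξ α F δ ≤ c := by
  refine limsup_le_of_le (by isBoundedDefault) (Eventually.of_forall fun i => ?_)
  have hpos : (0 : EReal) < ((d i : ℝ) : EReal) := by exact_mod_cast hd i
  rw [EReal.div_le_iff_le_mul hpos (EReal.coe_ne_top _)]
  have h1 : (homCard μ ξ α F δ (σ i) : ℝ≥0∞) ≤ ENNReal.ofReal (Real.exp (d i * c)) := by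
    rw [← ENNReal.ofReal_natCast]
    exact ENNReal.ofReal_le_ofReal (h i)
  refine (ENNReal.log_le_log h1).trans ?_
  rw [ENNReal.log_ofReal_of_pos (Real.exp_pos _), Real.log_exp, EReal.coe_mul]

theorem le_entropyFδ (hd : ∀ i, 0 < d i) {c : ℝ}
    (h : ∀ᶠ i in atTop, Real.exp (d i * c) ≤ (homCard μ ξ α F δ (σ i) : ℝ)) :
    (c : EReal) ≤ entropyFδ d σ μ ξ α F δ := by
  refine le_limsup_of_frequently_le (Eventually.frequently ?_) (by isBoundedDefault)
  filter_upwards [h] with i hi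
  have hpos : (0 : EReal) < ((d i : ℝ) : EReal) := by exact_mod_cast hd i
  rw [EReal.le_div_iff_mul_le hpos (EReal.coe_ne_top _)]
  have h1 : ENNReal.ofReal (Real.exp (d i * c)) ≤ (homCard μ ξ α F δ (σ i) : ℝ≥0∞) := by
    rw [← ENNReal.ofReal_natCast]
    exact ENNReal.ofReal_le_ofReal hi
  refine le_trans ?_ (ENNReal.log_le_log h1)
  rw [ENNReal.log_ofReal_of_pos (Real.exp_pos _), Real.log_exp, mul_comm (d i : ℝ), EReal.coe_mul]

end Limits

/-! ### Cylinder approximation and finite partitions -/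

section Cylinders

variable {ι Y : Type*}

/-- Membership in `A` only depends on which sets of `𝓑` contain the coordinates in `E`. -/
def DeterminedBy (E : Finset ι) (𝓑 : Finset (Set Y)) (A : Set (ι → Y)) : Prop :=
  ∀ x x' : ι → Y, (∀ t ∈ E, ∀ B ∈ 𝓑, (x t ∈ B ↔ x' t ∈ B)) → (x ∈ A ↔ x' ∈ A)

theorem DeterminedBy.mono {E E' : Finset ι} {𝓑 𝓑' : Finset (Set Y)} {A : Set (ι → Y)}
    (h : DeterminedBy E 𝓑 A) (hE : E ⊆ E') (h𝓑 : 𝓑 ⊆ 𝓑') : DeterminedBy E' 𝓑' A :=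
  fun x x' hx => h x x' fun t ht B hB => hx t (hE ht) B (h𝓑 hB)

/-- Measurable sets determined by finitely many coordinates and finitely many measurable sets form
an algebra that generates the product `σ`-algebra, so they are dense for the measure of symmetric
differences. -/
theorem exists_determinedBy_near [MeasurableSpace Y] (μ : Measure (ι → Y)) [IsFiniteMeasure μ]
    {A : Set (ι → Y)} (hA : MeasurableSet A) {ε : ℝ} (hε : 0 < ε) :
    ∃ (A' : Set (ι → Y)) (E : Finset ι) (𝓑 : Finset (Set Y)), MeasurableSet A' ∧
      (∀ B ∈ 𝓑, MeasurableSet B) ∧ DeterminedBy E 𝓑 A' ∧ μ.real (A' ∆ A) < ε := by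
  classical
  set 𝓒 : Set (Set (ι → Y)) := {A | MeasurableSet A ∧ ∃ (E : Finset ι) (𝓑 : Finset (Set Y)),
    (∀ B ∈ 𝓑, MeasurableSet B) ∧ DeterminedBy E 𝓑 A} with h𝓒
  have hring : IsSetAlgebra 𝓒 := by
    refine ⟨⟨MeasurableSet.empty, ∅, ∅, by simp, fun x x' _ => Iff.rfl⟩, ?_, ?_⟩
    · rintro A ⟨hA, E, 𝓑, h𝓑, h⟩
      exact ⟨hA.compl, E, 𝓑, h𝓑, fun x x' hx => not_congr (h x x' hx)⟩
    · rintro A A' ⟨hA, E, 𝓑, h𝓑, h⟩ ⟨hA', E', 𝓑', h𝓑', h'⟩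
      refine ⟨hA.union hA', E ∪ E', 𝓑 ∪ 𝓑', ?_, fun x x' hx => or_congr ?_ ?_⟩
      · intro B hB
        rcases Finset.mem_union.1 hB with hB | hB
        exacts [h𝓑 B hB, h𝓑' B hB]
      · exact h.mono Finset.subset_union_left Finset.subset_union_left x x' hx
      · exact h'.mono Finset.subset_union_right Finset.subset_union_right x x' hx
  have hgen : (MeasurableSpace.pi : MeasurableSpace (ι → Y)) =
      MeasurableSpace.generateFrom 𝓒 := by
    apply le_antisymm
    · refine iSup_le fun t => ?_
      rintro _ ⟨B, hB, rfl⟩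
      refine MeasurableSpace.measurableSet_generateFrom
        ⟨measurable_pi_apply t hB, {t}, {B}, by simpa using hB, fun x x' hx => ?_⟩
      exact hx t (by simp) B (by simp)
    · exact MeasurableSpace.generateFrom_le fun A hA => hA.1
  obtain ⟨A', ⟨hA', E, 𝓑, h𝓑, h⟩, hlt⟩ :=
    exists_measure_symmDiff_lt_of_generateFrom_isSetRing (μ := μ) hring.isSetRing
      ⟨{Set.univ}, by simp, by simpa using hring.univ_mem, by simp⟩ hgen hA
      (ENNReal.ofReal_pos.2 hε)
  refine ⟨A', E, 𝓑, hA', h𝓑, h, ?_⟩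
  exact (ENNReal.lt_ofReal_iff_toReal_lt (measure_ne_top _ _)).1 hlt

theorem exists_determinedBy_near_finset [MeasurableSpace Y] (μ : Measure (ι → Y))
    [IsFiniteMeasure μ] {ξ : Finset (Set (ι → Y))} (hξ : ∀ A ∈ ξ, MeasurableSet A) {ε : ℝ}
    (hε : 0 < ε) :
    ∃ (f : Set (ι → Y) → Set (ι → Y)) (E : Finset ι) (𝓑 : Finset (Set Y)),
      (∀ B ∈ 𝓑, MeasurableSet B) ∧ ∀ A ∈ ξ, MeasurableSet (f A) ∧ DeterminedBy E 𝓑 (f A) ∧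
        μ.real (f A ∆ A) < ε := by
  classical
  have hex : ∀ A : Set (ι → Y), ∃ (A' : Set (ι → Y)) (E : Finset ι) (𝓑 : Finset (Set Y)),
      (∀ B ∈ 𝓑, MeasurableSet B) ∧
      (A ∈ ξ → MeasurableSet A' ∧ DeterminedBy E 𝓑 A' ∧ μ.real (A' ∆ A) < ε) := by
    intro A
    by_cases hA : A ∈ ξ
    · obtain ⟨A', E, 𝓑, h1, h2, h3, h4⟩ := exists_determinedBy_near μ (hξ A hA) hε
      exact ⟨A', E, 𝓑, h2, fun _ => ⟨h1, h3, h4⟩⟩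
    · exact ⟨∅, ∅, ∅, by simp, fun h => absurd h hA⟩
  choose f E 𝓑 h𝓑 hf using hex
  refine ⟨f, ξ.biUnion E, ξ.biUnion 𝓑, ?_, fun A hA => ⟨(hf A hA).1, ?_, (hf A hA).2.2⟩⟩
  · intro B hB
    obtain ⟨A, -, hB⟩ := Finset.mem_biUnion.1 hB
    exact h𝓑 A B hB
  · exact (hf A hA).2.1.mono (Finset.subset_biUnion_of_mem E hA) (Finset.subset_biUnion_of_mem 𝓑 hA)

/-- Fibres are indexed by points of `X`, not by values in `J`, to leave out the empty ones, which
`Setoid.IsPartition` forbids. -/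
theorem exists_fiber_partition {X J : Type*} [Finite J] (S : MeasurableSpace X) (f : X → J)
    (hf : ∀ j, MeasurableSet[S] (f ⁻¹' {j})) :
    ∃ α : Finset (Set X), IsFinPartition S α ∧ ∀ A, A ∈ α ↔ ∃ x, A = f ⁻¹' {f x} := by
  have hfin : (Set.range fun x => f ⁻¹' {f x}).Finite :=
    (Set.finite_range fun j => f ⁻¹' {j}).subset (by rintro _ ⟨x, rfl⟩; exact ⟨f x, rfl⟩)
  have hmem : ∀ A, A ∈ hfin.toFinset ↔ ∃ x, A = f ⁻¹' {f x} := fun A => by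
    simp [eq_comm]
  refine ⟨hfin.toFinset, ⟨⟨?_, fun x => ⟨f ⁻¹' {f x}, ⟨by simp, rfl⟩, ?_⟩⟩, ?_⟩, hmem⟩
  · intro h
    obtain ⟨x, hx⟩ := (hmem _).1 h
    have : x ∈ f ⁻¹' {f x} := rfl
    rw [← hx] at this
    exact this
  · rintro A ⟨hA, hx⟩
    obtain ⟨y, rfl⟩ := (hmem A).1 hA
    have : f x = f y := hx
    simp [this]
  · intro A hA
    obtain ⟨x, rfl⟩ := (hmem A).1 hA
    exact hf _

theorem exists_partition_of_sets [MeasurableSpace Y] {𝓑 : Finset (Set Y)}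
    (h𝓑 : ∀ B ∈ 𝓑, MeasurableSet B) :
    ∃ η : Finset (Set Y), IsFinPartition inferInstance η ∧
      ∀ C ∈ η, ∀ y ∈ C, ∀ y' ∈ C, ∀ B ∈ 𝓑, (y ∈ B ↔ y' ∈ B) := by
  obtain ⟨η, hη, hmem⟩ := exists_fiber_partition (inferInstance : MeasurableSpace Y)
    (fun (y : Y) (B : 𝓑) => y ∈ (B : Set Y)) (fun j => by
      have : (fun (y : Y) (B : 𝓑) => y ∈ (B : Set Y)) ⁻¹' {j} =
          ⋂ B : 𝓑, {y | y ∈ (B : Set Y) ↔ j B} := by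
        ext y
        simp [funext_iff]
      rw [this]
      refine MeasurableSet.iInter fun B => ?_
      by_cases hj : j B
      · simpa [hj] using h𝓑 B B.2
      · convert (h𝓑 B B.2).compl using 1
        ext y
        simp [hj])
  refine ⟨η, hη, fun C hC y hy y' hy' B hB => ?_⟩
  obtain ⟨z, rfl⟩ := (hmem C).1 hC
  have h1 := congrFun hy ⟨B, hB⟩
  have h2 := congrFun hy' ⟨B, hB⟩
  exact iff_of_eq (h1.trans h2.symm)

theorem sum_measureReal_partition {X : Type*} [MeasurableSpace X] (μ : Measure X)
    [IsProbabilityMeasure μ] {α : Finset (Set X)} (hα : IsFinPartition inferInstance α) :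
    ∑ A ∈ α, μ.real A = 1 := by
  have h1 := measureReal_biUnion_finset (μ := μ) (s := α) (f := id)
    hα.1.pairwiseDisjoint hα.2
  have h2 : ⋃ A ∈ α, id A = Set.univ := by
    rw [← hα.1.sUnion_eq_univ, Set.sUnion_eq_biUnion]
    simp
  rw [h2, probReal_univ] at h1
  exact h1.symm

end Cylinders

/-! ### The shift action and the upper bound -/

section Shift

variable {G Y : Type*} [Group G]

theorem inv_smul_apply_one (t : G) (x : G → Y) : (t⁻¹ • x) 1 = x t := by
  change x (t⁻¹⁻¹ • (1 : G)) = x t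
  simp

theorem smul_arrow_apply (s t : G) (x : G → Y) : (s • x) t = x (s⁻¹ * t) := rfl

theorem measurableConstSMul_arrow [MeasurableSpace Y] : MeasurableConstSMul G (G → Y) :=
  ⟨fun s => measurable_pi_lambda _ fun t => measurable_pi_apply (s⁻¹ * t)⟩

theorem measureReal_eval [MeasurableSpace Y] {ι : Type*} (ν : Measure Y) [IsProbabilityMeasure ν]
    (i : ι) {C : Set Y} (hC : MeasurableSet C) :
    (Measure.infinitePi fun _ : ι => ν).real {z | z i ∈ C} = ν.real C := by
  have h := measurePreserving_eval_infinitePi (fun _ : ι => ν) i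
  exact congrArg ENNReal.toReal (h.measure_preimage hC.nullMeasurableSet)

section UpperBound

variable {ξ α : Finset (Set (G → Y))} {η : Finset (Set Y)} {F : Finset G}

/-- Outside of few indices, the points follow the word of cells at the identity. -/
theorem ncard_prediction_le [MeasurableSpace Y] (μ : Measure (G → Y)) [IsFiniteMeasure μ]
    (hξ : IsFinPartition inferInstance ξ) (hα : IsFinPartition inferInstance α)
    (hαξ : Refines α ξ) (hαη : ∀ A ∈ α, ∀ x ∈ A, ∀ y ∈ A, ∀ C ∈ η, x 1 ∈ C → y 1 ∈ C)
    {𝓑 : Finset (Set Y)} (hη𝓑 : ∀ C ∈ η, ∀ y ∈ C, ∀ y' ∈ C, ∀ B ∈ 𝓑, (y ∈ B ↔ y' ∈ B))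
    {E : Finset G} (hEF : E ⊆ F) (hF : 1 ∈ F) {A A' : Set (G → Y)} (hA : A ∈ ξ)
    (hA' : DeterminedBy E 𝓑 A') {ε : ℝ} (hε : μ.real (A' ∆ A) ≤ ε)
    {δ : ℝ} {d : ℕ} (hd : 0 < d) {σ : G → Equiv.Perm (Fin d)} {x : Fin d → G → Y}
    (hx : x ∈ pointMaps μ α F δ σ)
    {c : Y → η} (hc : ∀ x, ∀ C : η, x ∈ (C : Set Y) ↔ c x = C)
    {r : η → Y} (hr : ∀ C : η, r C ∈ (C : Set Y)) :
    (({k | (fun t => r (c (x ((σ t).symm k) 1))) ∈ A'} ∆ {k | x k ∈ A}).ncard : ℝ) ≤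
      d * (E.card * δ + δ + ε) := by
  classical
  have hd' : (0 : ℝ) < d := by exact_mod_cast hd
  have : MeasurableConstSMul G (G → Y) := measurableConstSMul_arrow
  -- Indices at which equivariance under `t` fails for some cell of `α`.
  set bad : G → Set (Fin d) := fun t => ⋃ D ∈ α, {k | ¬(x k ∈ D ↔ t⁻¹ • x (σ t k) ∈ D)} with hbad
  have hbad_le : ∀ t ∈ F, ((bad t).ncard : ℝ) ≤ d * δ := by
    intro t ht
    have h1 := (hx.1 t ht).le
    rw [← Finset.sum_div, div_le_iff₀ hd', mul_comm δ] at h1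
    refine le_trans ?_ h1
    exact_mod_cast Finset.set_ncard_biUnion_le α _
  -- `A' ∆ A` is a union of atoms: `A'` because `F` contains its window and `α` sees `η` at the
  -- identity, `A` because `α` refines `ξ`. Its frequency is thus within `δ` of its measure.
  have hD : (({k | x k ∈ A' ∆ A}.ncard : ℝ)) ≤ d * (δ + ε) := by
    have hsat : ∀ C ∈ translates α F, ∀ x ∈ C, ∀ y ∈ C, x ∈ A' ∆ A → y ∈ A' ∆ A := by
      intro C hC x hx y hy h
      have hAA : ∀ s ∈ F, ∀ D ∈ α, (s⁻¹ • x ∈ D ↔ s⁻¹ • y ∈ D) := fun s hs D hD =>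
        translates_smul_iff hα.1 hC hx hy hs hD
      have h1 : x ∈ A' ↔ y ∈ A' := by
        refine hA' x y fun t ht B hB => ?_
        obtain ⟨D, ⟨hD, hxD⟩, -⟩ := hα.1.2 (t⁻¹ • x)
        have hyD := (hAA t (hEF ht) D hD).1 hxD
        have h2 := hαη D hD _ hxD _ hyD (c (x t)) (c (x t)).2
        rw [inv_smul_apply_one, inv_smul_apply_one] at h2
        have h3 := (hc (x t) (c (x t))).2 rfl
        exact hη𝓑 _ (c (x t)).2 _ h3 _ (h2 h3) B hB
      have h2 : x ∈ A ↔ y ∈ A := by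
        obtain ⟨D, ⟨hD, hxD⟩, -⟩ := hα.1.2 x
        have hyD : y ∈ D := by simpa using (hAA 1 hF D hD).1 (by simpa using hxD)
        exact ⟨mem_of_refines hξ.1 hαξ hD hA hxD hyD, mem_of_refines hξ.1 hαξ hD hA hyD hxD⟩
      rw [Set.mem_symmDiff] at h ⊢
      tauto
    have h1 := abs_ncard_sub_lt hα.1 (fun C hC => measurableSet_translates hα.2 hC) hx hsat
    have h2 := (abs_lt.1 h1).2
    have h3 : ({k | x k ∈ A' ∆ A}.ncard : ℝ) / d ≤ δ + ε := by linarith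
    rw [div_le_iff₀ hd'] at h3
    linarith
  have hsub : {k | (fun t => r (c (x ((σ t).symm k) 1))) ∈ A'} ∆ {k | x k ∈ A} ⊆
      (⋃ t ∈ E, σ t '' bad t) ∪ {k | x k ∈ A' ∆ A} := by
    intro k hk
    by_contra hcon
    rw [Set.mem_union, not_or] at hcon
    obtain ⟨hcon1, hcon2⟩ := hcon
    -- If `(σ t)⁻¹ k` is not bad, the cell predicted for coordinate `t` is the true cell of `x k t`;
    -- replacing the coordinate by the representative `r` does not affect membership in the sets of
    -- `𝓑`.
    have h1 : (fun t => r (c (x ((σ t).symm k) 1))) ∈ A' ↔ x k ∈ A' := by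
      refine hA' _ _ fun t ht B hB => ?_
      have h2 : (σ t).symm k ∉ bad t := fun h => hcon1 (by
        simp only [Set.mem_iUnion]
        exact ⟨t, ht, _, h, by simp⟩)
      obtain ⟨D, ⟨hD, hxD⟩, -⟩ := hα.1.2 (x ((σ t).symm k))
      have h3 : t⁻¹ • x k ∈ D := by
        by_contra h4
        refine h2 (Set.mem_biUnion hD ?_)
        simp only [Set.mem_ofPred_eq, Equiv.apply_symm_apply]
        tauto
      set C := c (x ((σ t).symm k) 1) with hC
      have h5 := hαη D hD _ hxD _ h3 C C.2 ((hc _ _).2 hC.symm)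
      rw [inv_smul_apply_one] at h5
      exact hη𝓑 C C.2 _ (hr C) _ h5 B hB
    have h6 : ¬(x k ∈ A' ∆ A) := hcon2
    rw [Set.mem_symmDiff] at hk h6
    simp only [Set.mem_ofPred_eq] at hk
    tauto
  have h1 : ((⋃ t ∈ E, σ t '' bad t).ncard : ℝ) ≤ E.card * (d * δ) := by
    calc ((⋃ t ∈ E, σ t '' bad t).ncard : ℝ) ≤ ∑ t ∈ E, ((σ t '' bad t).ncard : ℝ) := by
          exact_mod_cast Finset.set_ncard_biUnion_le E _
      _ ≤ ∑ t ∈ E, (d * δ : ℝ) := by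
          refine Finset.sum_le_sum fun t ht => ?_
          rw [Set.ncard_image_of_injective _ (σ t).injective]
          exact hbad_le t (hEF ht)
      _ = E.card * (d * δ) := by rw [Finset.sum_const, nsmul_eq_mul]
  have h2 : (({k | (fun t => r (c (x ((σ t).symm k) 1))) ∈ A'} ∆ {k | x k ∈ A}).ncard : ℝ) ≤
      (⋃ t ∈ E, σ t '' bad t).ncard + {k | x k ∈ A' ∆ A}.ncard := by
    exact_mod_cast (Set.ncard_le_ncard hsub (Set.toFinite _)).trans (Set.ncard_union_le _ _)
  linarith

theorem ncard_univ_pi {J S : Type*} [Fintype J] [Finite S] (T : Set S) :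
    (Set.univ.pi fun _ : J => T).ncard = T.ncard ^ Fintype.card J := by
  classical
  have := Fintype.ofFinite S
  have h : (Set.univ.pi fun _ : J => T) = ↑(Fintype.piFinset fun _ : J => T.toFinset) := by
    rw [Fintype.coe_piFinset]
    simp
  rw [h, Set.ncard_coe_finset, Fintype.card_piFinset, Finset.prod_const, Finset.card_univ,
    Set.ncard_eq_toFinset_card']

/-- A trace on `ξ` is decoded by `Φ` from the word of `η`-cells and, for each member of `ξ`, the set
of wrongly predicted indices. The bound is the number of admissible words times the number of small
sets to the power `|ξ|`. -/
theorem homCard_le [MeasurableSpace Y] (ν : Measure Y) [IsProbabilityMeasure ν]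
    (hξ : IsFinPartition inferInstance ξ) (hα : IsFinPartition inferInstance α)
    (hη : IsFinPartition inferInstance η)
    (hαξ : Refines α ξ) (hαη : ∀ A ∈ α, ∀ x ∈ A, ∀ y ∈ A, ∀ C ∈ η, x 1 ∈ C → y 1 ∈ C)
    {𝓑 : Finset (Set Y)} (hη𝓑 : ∀ C ∈ η, ∀ y ∈ C, ∀ y' ∈ C, ∀ B ∈ 𝓑, (y ∈ B ↔ y' ∈ B))
    {E : Finset G} (hEF : E ⊆ F) (hF : 1 ∈ F) {f : Set (G → Y) → Set (G → Y)} {ε : ℝ}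
    (hf : ∀ A ∈ ξ, DeterminedBy E 𝓑 (f A) ∧
      (Measure.infinitePi fun _ : G => ν).real (f A ∆ A) ≤ ε)
    {δ : ℝ} {d : ℕ} (hd : 0 < d) {σ : G → Equiv.Perm (Fin d)}
    {q : Set Y → ℝ} (hq : ∀ C ∈ η, 0 < q C) (hq1 : ∑ C ∈ η, q C = 1)
    {θ : ℝ} (h0 : 0 < θ) (h1 : θ ≤ 1) :
    (homCard (Measure.infinitePi fun _ : G => ν) ξ α F δ σ : ℝ) ≤
      Real.exp (d * (∑ C ∈ η, (ν.real C + δ) * -Real.log (q C) +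
        ξ.card * (Real.log (1 + θ) - (E.card * δ + δ + ε) * Real.log θ))) := by
  classical
  have hd' : (0 : ℝ) < d := by exact_mod_cast hd
  have : MeasurableConstSMul G (G → Y) := measurableConstSMul_arrow
  obtain ⟨c, hc⟩ := exists_cell hη.1
  choose r hr using fun C : η => Setoid.nonempty_of_mem_partition hη.1 (Finset.mem_coe.2 C.2)
  set κ : ℝ := E.card * δ + δ + ε with hκ
  set W : Set (Fin d → η) :=
    {w | ∀ C : η, ({k | w k = C}.ncard : ℝ) ≤ d * (ν.real (C : Set Y) + δ)} with hW
  set S : Set (Set (Fin d)) := {S | (S.ncard : ℝ) ≤ d * κ} with hS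
  set Φ : (Fin d → η) × (ξ → Set (Fin d)) → ξ → Set (Fin d) := fun p B =>
    {k | (fun t => r (p.1 ((σ t).symm k))) ∈ f B} ∆ p.2 B with hΦ
  have hsub : (fun (x : Fin d → G → Y) (B : ξ) => {k | x k ∈ (B : Set (G → Y))}) ''
      pointMaps (Measure.infinitePi fun _ : G => ν) α F δ σ ⊆
      Φ '' (W ×ˢ Set.univ.pi fun _ : ξ => S) := by
    rintro _ ⟨x, hx, rfl⟩
    refine ⟨(fun k => c (x k 1), fun B =>
      {k | (fun t => r (c (x ((σ t).symm k) 1))) ∈ f B} ∆ {k | x k ∈ (B : Set (G → Y))}),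
      ⟨?_, ?_⟩, ?_⟩
    · intro C
      have hsat : ∀ D ∈ translates α F, ∀ x ∈ D, ∀ y ∈ D,
          x ∈ {z : G → Y | z 1 ∈ (C : Set Y)} → y ∈ {z : G → Y | z 1 ∈ (C : Set Y)} := by
        intro D hD x hx y hy h
        obtain ⟨A, ⟨hA, hxA⟩, -⟩ := hα.1.2 x
        have h2 := translates_smul_iff hα.1 hD hx hy hF hA
        simp only [inv_one, one_smul] at h2
        exact hαη A hA x hxA y (h2.1 hxA) C C.2 h
      have h2 := abs_ncard_sub_lt hα.1 (fun C hC => measurableSet_translates hα.2 hC) hx hsat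
      have h3 := (abs_lt.1 h2).2
      rw [measureReal_eval ν 1 (hη.2 C C.2)] at h3
      have h4 : {k | c (x k 1) = C} = {k | x k ∈ {z : G → Y | z 1 ∈ (C : Set Y)}} := by
        ext k
        exact (hc _ _).symm
      change (({k | c (x k 1) = C}).ncard : ℝ) ≤ _
      rw [h4]
      have h5 : ({k | x k ∈ {z : G → Y | z 1 ∈ (C : Set Y)}}.ncard : ℝ) / d ≤
          ν.real (C : Set Y) + δ := by
        linarith
      rw [div_le_iff₀ hd'] at h5
      linarith
    · intro B _
      exact ncard_prediction_le _ hξ hα hαξ hαη hη𝓑 hEF hF B.2 (hf B B.2).1 (hf B B.2).2 hd hx hc hr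
    · funext B
      exact symmDiff_symmDiff_cancel_left _ _
  have hWle : (W.ncard : ℝ) ≤ Real.exp (d * ∑ C : η, (ν.real (C : Set Y) + δ) * -Real.log (q C)) :=
    ncard_words_le (p := fun C : η => ν.real (C : Set Y)) (q := fun C : η => q C)
      (fun C => hq C C.2) (by rw [← hq1]; exact Finset.sum_coe_sort η q) fun w hw => hw
  have hSle : (S.ncard : ℝ) ≤ Real.exp (d * Real.log (1 + θ) - d * κ * Real.log θ) :=
    ncard_small_sets_le h0 h1
  rw [Finset.sum_coe_sort η fun C => (ν.real C + δ) * -Real.log (q C)] at hWle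
  rw [homCard_eq hα.1 hξ.1 hαξ hF]
  calc _ ≤ ((Φ '' (W ×ˢ Set.univ.pi fun _ : ξ => S)).ncard : ℝ) := by
        exact_mod_cast Set.ncard_le_ncard hsub (Set.toFinite _)
    _ ≤ ((W ×ˢ Set.univ.pi fun _ : ξ => S).ncard : ℝ) := by
        exact_mod_cast Set.ncard_image_le (Set.toFinite _)
    _ = W.ncard * S.ncard ^ ξ.card := by
        rw [Set.ncard_prod, ncard_univ_pi, Fintype.card_coe]
        push_cast
        rfl
    _ ≤ Real.exp (d * ∑ C ∈ η, (ν.real C + δ) * -Real.log (q C)) *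
        Real.exp (d * Real.log (1 + θ) - d * κ * Real.log θ) ^ ξ.card := by
        gcongr
    _ = _ := by
        rw [← Real.exp_nat_mul, ← Real.exp_add]
        congr 1
        ring

theorem entropyInf_le [MeasurableSpace Y] (ν : Measure Y) [IsProbabilityMeasure ν]
    {d : ℕ → ℕ} {σ : ∀ i, G → Equiv.Perm (Fin (d i))} (hd : ∀ i, 0 < d i)
    (hξ : IsFinPartition inferInstance ξ) {b c : ℝ} (hb : baseEntropy ν ≤ b) (hbc : b < c) :
    entropyInf MeasurableSpace.pi d σ (Measure.infinitePi fun _ : G => ν) ξ ≤ c := by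
  classical
  -- The slack `g` is spent in four quarters: on `log (1 + θ)`, on the approximation error `ε`, on
  -- smoothing `ν` by `κ`, and on `δ`. The order matters: `θ` depends on `|ξ|`, `ε` also on `log θ`,
  -- `κ` on the partition `η` that `ε` produces, and `δ` on everything before.
  set g := c - b with hg
  have hg0 : 0 < g := sub_pos.2 hbc
  set n : ℝ := (ξ.card : ℝ) with hn
  have hn0 : 0 ≤ n := Nat.cast_nonneg _
  set θ : ℝ := min 1 (g / (4 * (n + 1))) with hθ
  have hθ0 : 0 < θ := lt_min one_pos (by positivity)
  have hθ1 : θ ≤ 1 := min_le_left _ _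
  set L : ℝ := -Real.log θ with hL
  have hL0 : 0 ≤ L := by linarith [Real.log_nonpos hθ0.le hθ1]
  have hnθ : n * Real.log (1 + θ) ≤ g / 4 := by
    have h1 : Real.log (1 + θ) ≤ θ := by
      linarith [Real.log_le_sub_one_of_pos (x := 1 + θ) (by linarith)]
    have h2 : θ ≤ g / (4 * (n + 1)) := min_le_right _ _
    rw [le_div_iff₀ (by positivity)] at h2
    nlinarith [mul_le_mul_of_nonneg_left h1 hn0]
  set ε : ℝ := g / (4 * (n + 1) * (L + 1)) with hε
  have hε0 : 0 < ε := by positivity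
  have hnε : n * ε * L ≤ g / 4 := by
    have h2 : ε * (4 * (n + 1) * (L + 1)) = g := div_mul_cancel₀ _ (by positivity)
    nlinarith [mul_nonneg hε0.le hn0, mul_nonneg hε0.le hL0]
  obtain ⟨f, E, 𝓑, h𝓑, hf⟩ :=
    exists_determinedBy_near_finset (Measure.infinitePi fun _ : G => ν) hξ.2 hε0
  obtain ⟨η, hη, hη𝓑⟩ := exists_partition_of_sets h𝓑
  set m : ℝ := (η.card : ℝ) with hm
  have hm0 : 0 ≤ m := Nat.cast_nonneg _
  set κ : ℝ := g / (4 * (m + 1)) with hκ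
  have hκ0 : 0 < κ := by positivity
  have hmκ : Real.log (1 + κ * m) ≤ g / 4 := by
    have h1 := Real.log_le_sub_one_of_pos (x := 1 + κ * m) (by positivity)
    have h2 : κ * (4 * (m + 1)) = g := div_mul_cancel₀ _ (by positivity)
    linarith
  have hden : 0 < 1 + κ * m := by positivity
  -- Smoothing makes null cells positive, since a word within tolerance `δ` may still use them; it
  -- costs at most `log (1 + κ m)` in the entropy term.
  set q : Set Y → ℝ := fun C => (ν.real C + κ) / (1 + κ * m) with hq
  have hq0 : ∀ C, 0 < q C := fun C => by
    have : 0 ≤ ν.real C := measureReal_nonneg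
    positivity
  have hq1 : ∑ C ∈ η, q C = 1 := by
    rw [← Finset.sum_div, Finset.sum_add_distrib, sum_measureReal_partition ν hη,
      Finset.sum_const, nsmul_eq_mul, mul_comm κ, div_self (by rw [mul_comm]; exact hden.ne')]
  have hqle : ∀ C ∈ η, 0 ≤ -Real.log (q C) := fun C hC => by
    have h1 : q C ≤ 1 := by
      rw [← hq1]
      exact Finset.single_le_sum (fun i _ => (hq0 i).le) hC
    linarith [Real.log_nonpos (hq0 C).le h1]
  set M : ℝ := ∑ C ∈ η, -Real.log (q C) with hM
  have hM0 : 0 ≤ M := Finset.sum_nonneg hqle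
  have hent : ∑ C ∈ η, ν.real C * -Real.log (q C) ≤ b + g / 4 := by
    have h1 : ∀ C ∈ η, ν.real C * -Real.log (q C) ≤
        Real.negMulLog (ν.real C) + ν.real C * Real.log (1 + κ * m) := by
      intro C _
      have h0 : 0 ≤ ν.real C := measureReal_nonneg
      rcases h0.eq_or_lt with h2 | h2
      · simp [← h2]
      · have h3 : Real.log (ν.real C) ≤ Real.log (ν.real C + κ) :=
          Real.log_le_log h2 (by linarith)
        rw [hq, Real.log_div (by positivity) hden.ne', Real.negMulLog]
        nlinarith [mul_le_mul_of_nonneg_left h3 h0]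
    have h2 := Finset.sum_le_sum h1
    rw [Finset.sum_add_distrib, ← Finset.sum_mul, sum_measureReal_partition ν hη, one_mul] at h2
    have h3 : ((shannonEntropy ν η : ℝ) : EReal) ≤ b := (le_iSup₂ (f := fun (α : Finset (Set Y))
      (_ : IsFinPartition _ α) => (shannonEntropy ν α : EReal)) η hη).trans hb
    have h4 : shannonEntropy ν η ≤ b := by exact_mod_cast h3
    rw [shannonEntropy] at h4
    linarith
  set P : ℝ := M + n * (E.card + 1) * L with hP
  have hP0 : 0 ≤ P := by positivity
  set δ : ℝ := g / (4 * (P + 1)) with hδ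
  have hδ0 : 0 < δ := by positivity
  have hδP : δ * P ≤ g / 4 := by
    have h2 : δ * (4 * (P + 1)) = g := div_mul_cancel₀ _ (by positivity)
    linarith
  obtain ⟨cξ, hcξ⟩ := exists_cell hξ.1
  obtain ⟨cη, hcη⟩ := exists_cell hη.1
  -- The join of `ξ` with the pullback of `η` at the identity coordinate.
  obtain ⟨α, hα, hmem⟩ := exists_fiber_partition MeasurableSpace.pi
    (fun x : G → Y => (cξ x, cη (x 1))) (by
      rintro ⟨A, C⟩
      have : (fun x : G → Y => (cξ x, cη (x 1))) ⁻¹' {(A, C)} =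
          (A : Set (G → Y)) ∩ (fun x => x 1) ⁻¹' (C : Set Y) := by
        ext x
        simp [hcξ, hcη]
      rw [this]
      exact (hξ.2 A A.2).inter (measurable_pi_apply 1 (hη.2 C C.2)))
  have hαξ : Refines α ξ := by
    intro A hA
    obtain ⟨x, rfl⟩ := (hmem A).1 hA
    refine ⟨cξ x, (cξ x).2, fun y hy => (hcξ _ _).2 ?_⟩
    exact congrArg Prod.fst (hy : (cξ y, cη (y 1)) = _)
  have hαη : ∀ A ∈ α, ∀ x ∈ A, ∀ y ∈ A, ∀ C ∈ η, x 1 ∈ C → y 1 ∈ C := by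
    intro A hA x hx y hy C hC hxC
    obtain ⟨z, rfl⟩ := (hmem A).1 hA
    have h1 : cη (x 1) = cη (z 1) := congrArg Prod.snd (hx : (cξ x, cη (x 1)) = _)
    have h2 : cη (y 1) = cη (z 1) := congrArg Prod.snd (hy : (cξ y, cη (y 1)) = _)
    have h3 := (hcη (x 1) ⟨C, hC⟩).1 hxC
    exact (hcη (y 1) ⟨C, hC⟩).2 (by rw [h2, ← h1, h3])
  refine iInf₂_le_of_le α ⟨hα, hαξ⟩ ?_
  refine iInf₂_le_of_le (insert 1 E) (Finset.mem_insert_self _ _) ?_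
  refine iInf₂_le_of_le δ hδ0 ?_
  refine entropyFδ_le hd fun i => ?_
  refine (homCard_le ν hξ hα hη hαξ hαη hη𝓑 (Finset.subset_insert 1 E)
    (Finset.mem_insert_self 1 E) (fun A hA => ⟨(hf A hA).2.1, (hf A hA).2.2.le⟩) (hd i)
    (fun C _ => hq0 C) hq1 hθ0 hθ1).trans ?_
  rw [Real.exp_le_exp]
  refine mul_le_mul_of_nonneg_left ?_ (Nat.cast_nonneg _)
  have h5 : ∑ C ∈ η, (ν.real C + δ) * -Real.log (q C) =
      ∑ C ∈ η, ν.real C * -Real.log (q C) + δ * M := by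
    rw [hM, Finset.mul_sum, ← Finset.sum_add_distrib]
    exact Finset.sum_congr rfl fun C _ => by ring
  have h6 : Real.log θ = -L := by rw [hL, neg_neg]
  rw [h5, ← hn, h6]
  have h7 : δ * P = δ * M + n * ((E.card + 1) * δ) * L := by rw [hP]; ring
  have h8 : n * (Real.log (1 + θ) - (E.card * δ + δ + ε) * -L) =
      n * Real.log (1 + θ) + n * ((E.card + 1) * δ) * L + n * ε * L := by ring
  rw [h8]
  linarith

theorem soficEntropy_le [MeasurableSpace Y] (ν : Measure Y) [IsProbabilityMeasure ν]
    {d : ℕ → ℕ} {σ : ∀ i, G → Equiv.Perm (Fin (d i))} (hd : ∀ i, 0 < d i) :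
    soficEntropy d σ (Measure.infinitePi fun _ : G => ν) ≤ baseEntropy ν := by
  refine iSup₂_le fun ξ hξ => ?_
  -- Only real `c` above `H(ν)` are tested, so nothing remains to prove when `H(ν) = ∞`.
  refine EReal.le_of_forall_lt_iff_le.1 fun c hc => ?_
  obtain ⟨b, hb, hbc⟩ := EReal.lt_iff_exists_real_btwn.1 hc
  exact entropyInf_le ν hd hξ hb.le (by exact_mod_cast hbc)

end UpperBound

end Shift

/-! ### Laws and independence of reindexed i.i.d. coordinates -/

section ProductMeasure

variable {ι κ Y : Type*} [MeasurableSpace Y] (ν : Measure Y) [IsProbabilityMeasure ν]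

theorem measurable_reindex (j : κ → ι) : Measurable fun (ω : ι → Y) t => ω (j t) :=
  measurable_pi_lambda _ fun t => measurable_pi_apply (j t)

theorem measureReal_reindex {j : κ → ι} (hj : Function.Injective j) {D : Set (κ → Y)}
    (hD : MeasurableSet D) :
    (Measure.infinitePi fun _ : ι => ν).real {ω | (fun t => ω (j t)) ∈ D} =
      (Measure.infinitePi fun _ : κ => ν).real D := by
  have h := Measure.map_infinitePi_infinitePi_of_inj (P := fun _ : ι => ν) hj
  rw [← h, measureReal_def, measureReal_def, Measure.map_apply (measurable_reindex j) hD]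
  rfl

theorem measureReal_reindex_inter {j j' : κ → ι} (hj : Function.Injective j)
    (hj' : Function.Injective j') (hdis : Disjoint (Set.range j) (Set.range j'))
    {D : Set (κ → Y)} (hD : MeasurableSet D) :
    (Measure.infinitePi fun _ : ι => ν).real
        ({ω | (fun t => ω (j t)) ∈ D} ∩ {ω | (fun t => ω (j' t)) ∈ D}) =
      (Measure.infinitePi fun _ : κ => ν).real D * (Measure.infinitePi fun _ : κ => ν).real D := by
  have hind : ProbabilityTheory.iIndep
      (fun i => MeasurableSpace.comap (fun ω : ι → Y => ω i) inferInstance)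
      (Measure.infinitePi fun _ : ι => ν) :=
    ProbabilityTheory.iIndepFun_infinitePi (P := fun _ : ι => ν) (X := fun _ y => y)
      fun _ => measurable_id
  have hind2 := ProbabilityTheory.indep_iSup_of_disjoint
    (fun i => (measurable_pi_apply i).comap_le) hind hdis
  have hmeas : ∀ l : κ → ι, MeasurableSet[⨆ i ∈ Set.range l,
      MeasurableSpace.comap (fun ω : ι → Y => ω i) inferInstance]
        {ω : ι → Y | (fun t => ω (l t)) ∈ D} := by
    intro l
    refine @measurable_pi_lambda (ι → Y) κ (fun _ => Y) (⨆ i ∈ Set.range l,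
      MeasurableSpace.comap (fun ω : ι → Y => ω i) inferInstance) _ (fun ω t => ω (l t)) ?_ D hD
    intro t
    refine Measurable.of_comap_le ?_
    exact le_iSup₂ (f := fun i (_ : i ∈ Set.range l) =>
      MeasurableSpace.comap (fun ω : ι → Y => ω i) inferInstance) (l t) ⟨t, rfl⟩
  have h := (ProbabilityTheory.Indep_iff _ _ _).1 hind2 _ _ (hmeas j) (hmeas j')
  rw [measureReal_def, h, ENNReal.toReal_mul, ← measureReal_def, ← measureReal_def,
    measureReal_reindex ν hj hD, measureReal_reindex ν hj' hD]

theorem measureReal_rectangle {d : ℕ} {j : Fin d → ι} (hj : Function.Injective j)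
    {w : Fin d → Set Y} (hw : ∀ k, MeasurableSet (w k)) :
    (Measure.infinitePi fun _ : ι => ν).real {ω | ∀ k, ω (j k) ∈ w k} = ∏ k, ν.real (w k) := by
  have h1 := measureReal_reindex ν hj (D := Set.pi (Finset.univ : Finset (Fin d)) w)
    (MeasurableSet.pi (Finset.countable_toSet _) fun k _ => hw k)
  have h2 : {ω : ι → Y | (fun t => ω (j t)) ∈ Set.pi (Finset.univ : Finset (Fin d)) w} =
      {ω | ∀ k, ω (j k) ∈ w k} := by
    ext ω
    simp
  rw [← h2, h1, measureReal_def, Measure.infinitePi_pi _ fun k _ => hw k, ENNReal.toReal_prod]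
  rfl

end ProductMeasure

/-! ### Chebyshev and Markov bounds for counts of events -/

section SecondMoment

/-- Chebyshev's inequality for sums of indicators that are mostly pairwise independent. -/
theorem measure_deviation_le {Ω : Type*} [MeasurableSpace Ω] (P : Measure Ω)
    [IsProbabilityMeasure P] {d : ℕ} {S : Fin d → Set Ω} (hS : ∀ k, MeasurableSet (S k)) {p : ℝ}
    (hp0 : 0 ≤ p) (hp1 : p ≤ 1) {Q : Set (Fin d × Fin d)}
    (h1 : ∀ k l, (k, l) ∉ Q → P.real (S k) = p ∧ P.real (S l) = p ∧ P.real (S k ∩ S l) = p * p)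
    {τ : ℝ} (hτ : 0 < τ) (hd : 0 < d) :
    P.real {ω | τ ≤ |({k | ω ∈ S k}.ncard : ℝ) / d - p|} ≤ Q.ncard / (τ * d) ^ 2 := by
  classical
  have hd' : (0 : ℝ) < d := by exact_mod_cast hd
  set a : Fin d → Ω → ℝ := fun k ω => (S k).indicator 1 ω - p with ha
  have ha_int : ∀ k, Integrable (a k) P := fun k =>
    ((integrable_const (1 : ℝ)).indicator (hS k)).sub (integrable_const p)
  have ha_le : ∀ k ω, |a k ω| ≤ 1 := by
    intro k ω
    rw [abs_le]
    by_cases h : ω ∈ S k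
    · simp only [ha, Set.indicator_of_mem h, Pi.one_apply]
      constructor <;> linarith
    · simp only [ha, Set.indicator_of_notMem h]
      constructor <;> linarith
  have hmul_int : ∀ k l, Integrable (fun ω => a k ω * a l ω) P := fun k l =>
    (ha_int l).bdd_mul (ha_int k).aestronglyMeasurable
      (Eventually.of_forall fun ω => by simpa using ha_le k ω)
  -- Outside `Q` the covariance vanishes; inside it the trivial bound by one is used. The second
  -- moment is then at most `|Q|`.
  have hmul_le : ∀ k l, ∫ ω, a k ω * a l ω ∂P ≤ if (k, l) ∈ Q then 1 else 0 := by
    intro k l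
    split_ifs with h
    · calc ∫ ω, a k ω * a l ω ∂P ≤ ∫ _, (1 : ℝ) ∂P := by
            refine integral_mono (hmul_int k l) (integrable_const _) fun ω => ?_
            refine (le_abs_self _).trans ?_
            rw [abs_mul]
            exact mul_le_one₀ (ha_le k ω) (abs_nonneg _) (ha_le l ω)
        _ = 1 := by simp
    · obtain ⟨hk, hl, hkl⟩ := h1 k l h
      have hi : ∀ T, MeasurableSet T → Integrable (T.indicator (1 : Ω → ℝ)) P := fun T hT =>
        (integrable_const (1 : ℝ)).indicator hT
      have hexp : (fun ω => a k ω * a l ω) = fun ω =>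
          (S k ∩ S l).indicator 1 ω - p * (S k).indicator 1 ω - p * (S l).indicator 1 ω + p * p := by
        funext ω
        simp only [ha, Set.inter_indicator_one, Pi.mul_apply]
        ring
      have i1 := hi _ ((hS k).inter (hS l))
      have i2 := (hi _ (hS k)).const_mul p
      have i3 := (hi _ (hS l)).const_mul p
      have i12 : Integrable (fun ω => (S k ∩ S l).indicator (1 : Ω → ℝ) ω -
          p * (S k).indicator 1 ω) P := i1.sub i2
      have i123 : Integrable (fun ω => (S k ∩ S l).indicator (1 : Ω → ℝ) ω -
          p * (S k).indicator 1 ω - p * (S l).indicator 1 ω) P := i12.sub i3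
      rw [hexp, integral_add i123 (integrable_const _), integral_sub i12 i3, integral_sub i1 i2,
        integral_const_mul, integral_const_mul,
        integral_indicator_one ((hS k).inter (hS l)), integral_indicator_one (hS k),
        integral_indicator_one (hS l), hk, hl, hkl]
      simp
  have hN : ∀ ω, ∑ k, a k ω = ({k | ω ∈ S k}.ncard : ℝ) - d * p := by
    intro ω
    simp only [ha, Finset.sum_sub_distrib, Finset.sum_const, Finset.card_univ, Fintype.card_fin,
      nsmul_eq_mul]
    congr 1
    rw [Set.ncard_eq_toFinset_card', Set.toFinset_ofPred, Finset.card_filter]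
    push_cast
    exact Finset.sum_congr rfl fun k _ => by simp [Set.indicator_apply]
  have hsq : ∀ ω, (∑ k, a k ω) ^ 2 = ∑ k, ∑ l, a k ω * a l ω := fun ω => by
    rw [sq, Finset.sum_mul_sum]
  have hsq_int : Integrable (fun ω => (∑ k, a k ω) ^ 2) P := by
    simp only [hsq]
    exact integrable_finsetSum _ fun k _ => integrable_finsetSum _ fun l _ => hmul_int k l
  have hmain : ∫ ω, (∑ k, a k ω) ^ 2 ∂P ≤ Q.ncard := by
    simp only [hsq]
    rw [integral_finsetSum _ fun k _ => integrable_finsetSum _ fun l _ => hmul_int k l]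
    calc _ = ∑ k, ∑ l, ∫ ω, a k ω * a l ω ∂P :=
          Finset.sum_congr rfl fun k _ => integral_finsetSum _ fun l _ => hmul_int k l
      _ ≤ ∑ k, ∑ l, if (k, l) ∈ Q then (1 : ℝ) else 0 :=
          Finset.sum_le_sum fun k _ => Finset.sum_le_sum fun l _ => hmul_le k l
      _ = Q.ncard := by
          rw [← Finset.sum_product', Set.ncard_eq_toFinset_card', Finset.univ_product_univ,
            Finset.sum_boole]
          congr 2
          ext x
          simp
  have hmarkov := mul_meas_ge_le_integral_of_nonneg (μ := P)
    (Eventually.of_forall fun ω => sq_nonneg (∑ k, a k ω)) hsq_int ((τ * d) ^ 2)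
  rw [le_div_iff₀ (by positivity), mul_comm]
  refine le_trans ?_ (hmarkov.trans hmain)
  refine mul_le_mul_of_nonneg_left (measureReal_mono ?_) (by positivity)
  intro ω hω
  change τ ≤ _ at hω
  change (τ * d) ^ 2 ≤ (∑ k, a k ω) ^ 2
  rw [← sq_abs (∑ k, a k ω), hN]
  refine pow_le_pow_left₀ (by positivity) ?_ 2
  have h2 : ({k | ω ∈ S k}.ncard : ℝ) - d * p = (({k | ω ∈ S k}.ncard : ℝ) / d - p) * d := by
    field_simp
  rw [h2, abs_mul, abs_of_pos hd']
  exact mul_le_mul_of_nonneg_right hω hd'.le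

/-- Markov's inequality: good indices contribute at most `ε` each to the expected count, and those
in `Q` at most one. -/
theorem measure_sum_ncard_le {Ω J : Type*} [MeasurableSpace Ω] (P : Measure Ω)
    [IsProbabilityMeasure P] {d : ℕ} {α : Finset J} {S : J → Fin d → Set Ω}
    (hS : ∀ A ∈ α, ∀ k, MeasurableSet (S A k)) {ε : ℝ} (hε : 0 ≤ ε) {Q : Set (Fin d)}
    (h1 : ∀ A ∈ α, ∀ k ∉ Q, P.real (S A k) ≤ ε) {τ : ℝ} (hτ : 0 < τ) (hd : 0 < d) :
    P.real {ω | τ ≤ ∑ A ∈ α, ({k | ω ∈ S A k}.ncard : ℝ) / d} ≤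
      α.card * (ε + Q.ncard / d) / τ := by
  classical
  have hd' : (0 : ℝ) < d := by exact_mod_cast hd
  have hN : ∀ A ω, ({k | ω ∈ S A k}.ncard : ℝ) = ∑ k, (S A k).indicator 1 ω := by
    intro A ω
    rw [Set.ncard_eq_toFinset_card', Set.toFinset_ofPred, Finset.card_filter]
    push_cast
    exact Finset.sum_congr rfl fun k _ => by simp [Set.indicator_apply]
  have hint : ∀ A ∈ α, ∀ k, Integrable ((S A k).indicator (1 : Ω → ℝ)) P := fun A hA k =>
    (integrable_const (1 : ℝ)).indicator (hS A hA k)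
  have hint2 : ∀ A ∈ α, Integrable (fun ω => (∑ k, (S A k).indicator (1 : Ω → ℝ) ω) / d) P :=
    fun A hA => (integrable_finsetSum _ fun k _ => hint A hA k).div_const _
  have hle : ∀ A ∈ α, ∫ ω, (∑ k, (S A k).indicator (1 : Ω → ℝ) ω) / d ∂P ≤ ε + Q.ncard / d := by
    intro A hA
    rw [integral_div, integral_finsetSum _ fun k _ => hint A hA k, div_le_iff₀ hd']
    calc ∑ k, ∫ ω, (S A k).indicator (1 : Ω → ℝ) ω ∂P
        ≤ ∑ k, (ε + if k ∈ Q then 1 else 0) := by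
          refine Finset.sum_le_sum fun k _ => ?_
          rw [integral_indicator_one (hS A hA k)]
          split_ifs with h
          · linarith [measureReal_le_one (μ := P) (s := S A k)]
          · linarith [h1 A hA k h]
      _ = (ε + Q.ncard / d) * d := by
          rw [Finset.sum_add_distrib, Finset.sum_boole, Finset.sum_const, Finset.card_univ,
            Fintype.card_fin, nsmul_eq_mul, Set.ncard_eq_toFinset_card', add_mul,
            div_mul_cancel₀ _ hd'.ne', mul_comm]
          congr 3
          ext k
          simp
  have hmarkov := mul_meas_ge_le_integral_of_nonneg (μ := P)
    (f := fun ω => ∑ A ∈ α, (∑ k, (S A k).indicator (1 : Ω → ℝ) ω) / d)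
    (Eventually.of_forall fun ω => Finset.sum_nonneg fun A _ => div_nonneg
      (Finset.sum_nonneg fun k _ => Set.indicator_nonneg (fun _ _ => zero_le_one) _) hd'.le)
    (integrable_finsetSum _ hint2) τ
  rw [integral_finsetSum _ hint2] at hmarkov
  have h3 := hmarkov.trans (Finset.sum_le_sum hle)
  rw [Finset.sum_const, nsmul_eq_mul] at h3
  rw [le_div_iff₀ hτ, mul_comm]
  simpa only [hN] using h3

end SecondMoment

/-! ### Random almost equivariant families of points -/

section RandomPoints

variable {G Y : Type*} [Group G]

open Classical in
/-- The index of the coordinate at `t` of the `k`-th random point: on the window `E` the points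
share their coordinates along `σ`, outside of it they have coordinates of their own. -/
noncomputable def pick {d : ℕ} (E : Finset G) (σ : G → Equiv.Perm (Fin d)) (k : Fin d) (t : G) :
    Fin d ⊕ (Fin d × G) :=
  if t ∈ E then Sum.inl (σ t⁻¹ k) else Sum.inr (k, t)

theorem pick_of_mem {d : ℕ} {E : Finset G} {σ : G → Equiv.Perm (Fin d)} {k : Fin d} {t : G}
    (ht : t ∈ E) : pick E σ k t = Sum.inl (σ t⁻¹ k) := if_pos ht

theorem pick_of_notMem {d : ℕ} {E : Finset G} {σ : G → Equiv.Perm (Fin d)} {k : Fin d} {t : G}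
    (ht : t ∉ E) : pick E σ k t = Sum.inr (k, t) := if_neg ht

/-- Injectivity makes the coordinates of the `k`-th random point independent, so that its law is
exactly `ν^G`. -/
theorem pick_injective {d : ℕ} {E : Finset G} {σ : G → Equiv.Perm (Fin d)} {k : Fin d}
    (h : Set.InjOn (fun t => σ t⁻¹ k) (E : Set G)) : Function.Injective (pick E σ k) := by
  intro t t' htt
  by_cases ht : t ∈ E <;> by_cases ht' : t' ∈ E
  · rw [pick_of_mem ht, pick_of_mem ht'] at htt
    exact h ht ht' (Sum.inl_injective htt)
  · rw [pick_of_mem ht, pick_of_notMem ht'] at htt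
    cases htt
  · rw [pick_of_notMem ht, pick_of_mem ht'] at htt
    cases htt
  · rw [pick_of_notMem ht, pick_of_notMem ht'] at htt
    exact congrArg Prod.snd (Sum.inr_injective htt)

theorem disjoint_range_pick {d : ℕ} {E : Finset G} (hE : 1 ∈ E) {σ : G → Equiv.Perm (Fin d)}
    {k l : Fin d} (h : ∀ t ∈ E, ∀ t' ∈ E, σ t⁻¹ k ≠ σ t'⁻¹ l) :
    Disjoint (Set.range (pick E σ k)) (Set.range (pick E σ l)) := by
  refine Set.disjoint_left.2 ?_
  rintro _ ⟨t, rfl⟩ ⟨t', htt⟩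
  by_cases ht : t ∈ E <;> by_cases ht' : t' ∈ E
  · rw [pick_of_mem ht, pick_of_mem ht'] at htt
    exact h t ht t' ht' (Sum.inl_injective htt).symm
  · rw [pick_of_mem ht, pick_of_notMem ht'] at htt
    cases htt
  · rw [pick_of_notMem ht, pick_of_mem ht'] at htt
    cases htt
  · rw [pick_of_notMem ht, pick_of_notMem ht'] at htt
    -- Fresh coordinates collide only if `k = l`, which `h` at `t = t' = 1` excludes.
    have hkl : l = k := congrArg Prod.fst (Sum.inr_injective htt)
    exact h 1 hE 1 hE (by rw [hkl])

/-- For fixed `t` and `t'` the first index determines the second, so the pairs with overlapping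
windows number only linearly in `d`. This makes the Chebyshev bound vanish as `d` grows. -/
theorem ncard_overlaps_le {d : ℕ} (E : Finset G) (σ : G → Equiv.Perm (Fin d)) (B : Set (Fin d)) :
    ({x : Fin d × Fin d | x.1 ∈ B ∨ x.2 ∈ B ∨ ∃ t ∈ E, ∃ t' ∈ E, σ t⁻¹ x.1 = σ t'⁻¹ x.2}.ncard : ℝ)
      ≤ 2 * B.ncard * d + E.card ^ 2 * d := by
  classical
  have hsub : {x : Fin d × Fin d | x.1 ∈ B ∨ x.2 ∈ B ∨ ∃ t ∈ E, ∃ t' ∈ E,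
      σ t⁻¹ x.1 = σ t'⁻¹ x.2} ⊆ (B ×ˢ Set.univ ∪ Set.univ ×ˢ B) ∪
        ⋃ p ∈ E ×ˢ E, (fun k => (k, (σ p.2⁻¹).symm (σ p.1⁻¹ k))) '' Set.univ := by
    rintro ⟨k, l⟩ (h | h | ⟨t, ht, t', ht', h⟩)
    · exact Or.inl (Or.inl ⟨h, trivial⟩)
    · exact Or.inl (Or.inr ⟨trivial, h⟩)
    · refine Or.inr (Set.mem_biUnion (Finset.mk_mem_product ht ht') ⟨k, trivial, ?_⟩)
      simp only [Prod.mk.injEq, true_and]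
      rw [Equiv.symm_apply_eq]
      exact h
  have h1 : ∀ p ∈ E ×ˢ E,
      ((fun k => (k, (σ p.2⁻¹).symm (σ p.1⁻¹ k))) '' (Set.univ : Set (Fin d))).ncard ≤ d := by
    intro p _
    refine (Set.ncard_image_le (Set.toFinite _)).trans ?_
    simp [Set.ncard_univ]
  have h2 := (Finset.set_ncard_biUnion_le (E ×ˢ E) fun p =>
    (fun k => (k, (σ p.2⁻¹).symm (σ p.1⁻¹ k))) '' (Set.univ : Set (Fin d))).trans
      (Finset.sum_le_card_nsmul _ _ d h1)
  have h3 := (Set.ncard_le_ncard hsub (Set.toFinite _)).trans ((Set.ncard_union_le _ _).trans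
    (add_le_add (Set.ncard_union_le _ _) h2))
  rw [Set.ncard_prod, Set.ncard_prod, Set.ncard_univ, Nat.card_eq_fintype_card, Fintype.card_fin,
    Finset.card_product, smul_eq_mul] at h3
  have h4 : ({x : Fin d × Fin d | x.1 ∈ B ∨ x.2 ∈ B ∨ ∃ t ∈ E, ∃ t' ∈ E,
      σ t⁻¹ x.1 = σ t'⁻¹ x.2}.ncard : ℝ) ≤
      (B.ncard * d + d * B.ncard + E.card * E.card * d : ℕ) := by exact_mod_cast h3
  push_cast at h4
  linarith

variable [MeasurableSpace Y] (ν : Measure Y) [IsProbabilityMeasure ν]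
  {α : Finset (Set (G → Y))} {F : Finset G}

/-- For the cylinder `A'` both memberships read the same labels and always agree. Replacing `A'` by
`A` costs `ε` on each side, as both points have law `ν^G`. -/
theorem measure_not_equivariant_le {E E₀ : Finset G} {𝓑 : Finset (Set Y)} {A A' : Set (G → Y)}
    (hA : MeasurableSet A) (hA' : MeasurableSet A') (hdet : DeterminedBy E₀ 𝓑 A') {ε : ℝ}
    (hε : (Measure.infinitePi fun _ : G => ν).real (A' ∆ A) ≤ ε)
    {d : ℕ} {σ : G → Equiv.Perm (Fin d)} {s : G} {k : Fin d}
    (hE₀ : E₀ ⊆ E) (hsE₀ : ∀ t ∈ E₀, s * t ∈ E)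
    (hk : Set.InjOn (fun t => σ t⁻¹ k) (E : Set G))
    (hsk : Set.InjOn (fun t => σ t⁻¹ (σ s k)) (E : Set G))
    (hmul : ∀ t ∈ E₀, σ t⁻¹ k = σ (s * t)⁻¹ (σ s k)) :
    (Measure.infinitePi fun _ : Fin d ⊕ (Fin d × G) => ν).real
      {ω | ¬((fun t => ω (pick E σ k t)) ∈ A ↔
        s⁻¹ • (fun t => ω (pick E σ (σ s k) t)) ∈ A)} ≤ 2 * ε := by
  have hsmul : ∀ ω : Fin d ⊕ (Fin d × G) → Y, s⁻¹ • (fun t => ω (pick E σ (σ s k) t)) =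
      fun t => ω (pick E σ (σ s k) (s * t)) := by
    intro ω
    funext t
    rw [smul_arrow_apply, inv_inv]
  have hD : MeasurableSet (A' ∆ A) := hA'.symmDiff hA
  have hsub : {ω | ¬((fun t => ω (pick E σ k t)) ∈ A ↔
      s⁻¹ • (fun t => ω (pick E σ (σ s k) t)) ∈ A)} ⊆
      {ω : Fin d ⊕ (Fin d × G) → Y | (fun t => ω (pick E σ k t)) ∈ A' ∆ A} ∪
        {ω | (fun t => ω (pick E σ (σ s k) (s * t))) ∈ A' ∆ A} := by
    intro ω hω
    have h1 : (fun t => ω (pick E σ k t)) ∈ A' ↔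
        (fun t => ω (pick E σ (σ s k) (s * t))) ∈ A' := by
      refine hdet _ _ fun t ht B _ => ?_
      rw [pick_of_mem (hE₀ ht), pick_of_mem (hsE₀ t ht), hmul t ht]
    rw [Set.mem_ofPred_eq, hsmul] at hω
    simp only [Set.mem_union, Set.mem_ofPred_eq, Set.mem_symmDiff]
    tauto
  have h1 := measureReal_reindex ν (pick_injective hk) hD
  have h2 := measureReal_reindex ν
    ((pick_injective hsk).comp (mul_right_injective s)) hD
  refine (measureReal_mono hsub).trans ((measureReal_union_le _ _).trans ?_)
  simp only [Function.comp_apply] at h2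
  rw [h1, h2]
  linarith

/-- Union bound over the elements of `F` (equivariance, by Markov) and the atoms in `α_F`
(frequencies, by Chebyshev with exceptional pairs those that meet `B` or have overlapping windows).
-/
theorem measure_not_pointMaps_le (hα : IsFinPartition inferInstance α)
    {E E₀ : Finset G} {𝓑 : Finset (Set Y)} {f : Set (G → Y) → Set (G → Y)} {ε : ℝ} (hε : 0 ≤ ε)
    (hf : ∀ A ∈ α, MeasurableSet (f A) ∧ DeterminedBy E₀ 𝓑 (f A) ∧
      (Measure.infinitePi fun _ : G => ν).real (f A ∆ A) < ε)
    (hE1 : 1 ∈ E) (hE₀ : E₀ ⊆ E) (hFE₀ : ∀ s ∈ F, ∀ t ∈ E₀, s * t ∈ E)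
    {d : ℕ} (hd : 0 < d) {σ : G → Equiv.Perm (Fin d)} {B : Set (Fin d)}
    (hB1 : ∀ k ∉ B, Set.InjOn (fun t => σ t⁻¹ k) (E : Set G))
    (hB2 : ∀ k ∉ B, ∀ s ∈ F, Set.InjOn (fun t => σ t⁻¹ (σ s k)) (E : Set G))
    (hB3 : ∀ k ∉ B, ∀ s ∈ F, ∀ t ∈ E₀, σ t⁻¹ k = σ (s * t)⁻¹ (σ s k))
    {δ τ : ℝ} (hδ : 0 < δ) (hτ : 0 < τ) (hτδ : (translates α F).card * τ < δ) :
    (Measure.infinitePi fun _ : Fin d ⊕ (Fin d × G) => ν).real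
      {ω | (fun k t => ω (pick E σ k t)) ∉
        pointMaps (Measure.infinitePi fun _ : G => ν) α F δ σ} ≤
      F.card * (α.card * (2 * ε + B.ncard / d) / δ) +
        (translates α F).card * ((2 * B.ncard * d + E.card ^ 2 * d) / (τ * d) ^ 2) := by
  classical
  set P := Measure.infinitePi fun _ : Fin d ⊕ (Fin d × G) => ν with hP
  set μ := Measure.infinitePi fun _ : G => ν with hμ
  have hsmul : MeasurableConstSMul G (G → Y) := measurableConstSMul_arrow
  set U : G → Set (Fin d ⊕ (Fin d × G) → Y) := fun s => {ω | δ ≤ ∑ A ∈ α,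
    ({k | ω ∈ {ω : Fin d ⊕ (Fin d × G) → Y | ¬((fun t => ω (pick E σ k t)) ∈ A ↔
        s⁻¹ • (fun t => ω (pick E σ (σ s k) t)) ∈ A)}}.ncard : ℝ) / d} with hU
  set V : Set (G → Y) → Set (Fin d ⊕ (Fin d × G) → Y) := fun C => {ω | τ ≤
    |({k | ω ∈ {ω : Fin d ⊕ (Fin d × G) → Y | (fun t => ω (pick E σ k t)) ∈ C}}.ncard : ℝ) / d -
      μ.real C|} with hV
  have hsub : {ω | (fun k t => ω (pick E σ k t)) ∉ pointMaps μ α F δ σ} ⊆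
      (⋃ s ∈ F, U s) ∪ ⋃ C ∈ translates α F, V C := by
    intro ω hω
    by_contra hcon
    simp only [Set.mem_union, Set.mem_iUnion, not_or, not_exists] at hcon
    refine hω ⟨fun s hs => not_le.1 (hcon.1 s hs), ?_⟩
    refine (Finset.sum_le_card_nsmul _ _ τ fun C hC => (not_le.1 (hcon.2 C hC)).le).trans_lt ?_
    rwa [nsmul_eq_mul]
  have hUle : ∀ s ∈ F, P.real (U s) ≤ α.card * (2 * ε + B.ncard / d) / δ := by
    intro s hs
    refine measure_sum_ncard_le P (fun A hA k => ?_) (by positivity) (fun A hA k hk => ?_) hδ hd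
    · have h1 : MeasurableSet {ω : Fin d ⊕ (Fin d × G) → Y | (fun t => ω (pick E σ k t)) ∈ A} :=
        measurable_reindex _ (hα.2 A hA)
      have h2 : MeasurableSet {ω : Fin d ⊕ (Fin d × G) → Y |
          s⁻¹ • (fun t => ω (pick E σ (σ s k) t)) ∈ A} :=
        ((measurable_const_smul s⁻¹).comp (measurable_reindex _)) (hα.2 A hA)
      exact (h1.iff h2).compl
    · exact measure_not_equivariant_le ν (hα.2 A hA) (hf A hA).1 (hf A hA).2.1 (hf A hA).2.2.le
        hE₀ (hFE₀ s hs) (hB1 k hk) (hB2 k hk s hs) (hB3 k hk s hs)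
  have hVle : ∀ C ∈ translates α F,
      P.real (V C) ≤ (2 * B.ncard * d + E.card ^ 2 * d) / (τ * d) ^ 2 := by
    intro C hC
    have hCm := measurableSet_translates hα.2 hC
    refine (measure_deviation_le P (fun k => measurable_reindex _ hCm) measureReal_nonneg
      measureReal_le_one (fun k l hkl => ?_) hτ hd).trans
      (div_le_div_of_nonneg_right (ncard_overlaps_le E σ B) (by positivity))
    simp only [Set.mem_ofPred_eq, not_or, not_exists, not_and] at hkl
    have hk := pick_injective (hB1 k hkl.1)
    have hl := pick_injective (hB1 l hkl.2.1)
    exact ⟨measureReal_reindex ν hk hCm, measureReal_reindex ν hl hCm,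
      measureReal_reindex_inter ν hk hl (disjoint_range_pick hE1 hkl.2.2) hCm⟩
  calc _ ≤ P.real (⋃ s ∈ F, U s) + P.real (⋃ C ∈ translates α F, V C) :=
        (measureReal_mono hsub).trans (measureReal_union_le _ _)
    _ ≤ ∑ s ∈ F, P.real (U s) + ∑ C ∈ translates α F, P.real (V C) :=
        add_le_add (measureReal_biUnion_finset_le _ _) (measureReal_biUnion_finset_le _ _)
    _ ≤ _ := by
        refine add_le_add ?_ ?_
        · refine (Finset.sum_le_card_nsmul _ _ _ hUle).trans_eq (nsmul_eq_mul _ _)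
        · refine (Finset.sum_le_card_nsmul _ _ _ hVle).trans_eq (nsmul_eq_mul _ _)

/-- Typical words have small probability, so an event of probability `1/2` sees many of them. -/
theorem exp_le_homCard {ξ : Finset (Set (G → Y))} {η : Finset (Set Y)}
    (hη : IsFinPartition inferInstance η) (hξ : IsFinPartition inferInstance ξ)
    (hα : IsFinPartition inferInstance α) (hαξ : Refines α ξ) (hF : 1 ∈ F)
    (hξη : ∀ C ∈ η, {x : G → Y | x 1 ∈ C} ∈ ξ)
    {E : Finset G} (hE : 1 ∈ E) {δ : ℝ} {d : ℕ} (hd : 0 < d) {σ : G → Equiv.Perm (Fin d)}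
    (hP : (Measure.infinitePi fun _ : Fin d ⊕ (Fin d × G) => ν).real
      {ω | (fun k t => ω (pick E σ k t)) ∉
        pointMaps (Measure.infinitePi fun _ : G => ν) α F δ σ} ≤ 1 / 2) :
    Real.exp (d * (shannonEntropy ν η - δ * ∑ C ∈ η, -Real.log (ν.real C))) ≤
      2 * homCard (Measure.infinitePi fun _ : G => ν) ξ α F δ σ := by
  classical
  have hd' : (0 : ℝ) < d := by exact_mod_cast hd
  have hsmul : MeasurableConstSMul G (G → Y) := measurableConstSMul_arrow
  set P := Measure.infinitePi fun _ : Fin d ⊕ (Fin d × G) => ν with hPdef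
  set μ := Measure.infinitePi fun _ : G => ν with hμ
  set X : (Fin d ⊕ (Fin d × G) → Y) → Fin d → G → Y := fun ω k t => ω (pick E σ k t) with hX
  obtain ⟨c, hc⟩ := exists_cell hη.1
  set e := Real.exp (-(d * (shannonEntropy ν η - δ * ∑ C ∈ η, -Real.log (ν.real C)))) with he
  set R : (Fin d → G → Y) → ξ → Set (Fin d) := fun x D => {k | x k ∈ (D : Set (G → Y))} with hR
  -- Since `ξ` contains the pullback of `η`, the trace fixes the cell of the label `σ 1 k` for every
  -- `k`. These labels are distinct, so the probability is bounded by a product over the word.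
  have hword : ∀ ω₀, X ω₀ ∈ pointMaps μ α F δ σ → P.real {ω | R (X ω) = R (X ω₀)} ≤ e := by
    intro ω₀ hω₀
    set w : Fin d → η := fun k => c (X ω₀ k 1) with hw
    have h1 : {ω | R (X ω) = R (X ω₀)} ⊆ {ω | ∀ k, ω (Sum.inl (σ 1 k)) ∈ (w k : Set Y)} := by
      intro ω hω k
      have h2 := congrFun hω ⟨_, hξη (w k) (w k).2⟩
      have h3 : k ∈ R (X ω₀) ⟨_, hξη (w k) (w k).2⟩ := (hc _ _).2 rfl
      rw [← h2] at h3
      have h4 : X ω k 1 ∈ (w k : Set Y) := h3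
      simpa only [hX, pick_of_mem hE, inv_one] using h4
    refine (measureReal_mono h1).trans ?_
    have h9 := measureReal_rectangle ν
      ((Sum.inl_injective (β := Fin d × G)).comp (σ 1).injective)
      (w := fun k => (w k : Set Y)) fun k => hη.2 _ (w k).2
    simp only [Function.comp_apply] at h9
    rw [hPdef, h9]
    -- A word with a null letter has probability zero; it is split off because `Real.log 0 = 0`
    -- would give the wrong exponential.
    by_cases h0 : ∃ k, ν.real (w k : Set Y) = 0
    · obtain ⟨k, hk⟩ := h0
      rw [Finset.prod_eq_zero (Finset.mem_univ k) hk]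
      exact (Real.exp_pos _).le
    · push Not at h0
      have h2 : ∏ k, ν.real (w k : Set Y) = Real.exp (∑ k, Real.log (ν.real (w k : Set Y))) := by
        rw [Real.exp_sum]
        exact Finset.prod_congr rfl fun k _ =>
          (Real.exp_log (lt_of_le_of_ne measureReal_nonneg (h0 k).symm)).symm
      rw [h2, he, Real.exp_le_exp, sum_word w fun C => Real.log (ν.real (C : Set Y)),
        shannonEntropy, Finset.mul_sum, ← Finset.sum_sub_distrib, Finset.mul_sum,
        ← Finset.sum_neg_distrib, ← Finset.sum_coe_sort η]
      refine Finset.sum_le_sum fun C _ => ?_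
      have hsat : ∀ D ∈ translates α F, ∀ x ∈ D, ∀ y ∈ D,
          x ∈ {z : G → Y | z 1 ∈ (C : Set Y)} → y ∈ {z : G → Y | z 1 ∈ (C : Set Y)} := by
        intro D hD x hx y hy h
        obtain ⟨A, ⟨hA, hxA⟩, -⟩ := hα.1.2 x
        have h2 := translates_smul_iff hα.1 hD hx hy hF hA
        simp only [inv_one, one_smul] at h2
        exact mem_of_refines hξ.1 hαξ hA (hξη C C.2) hxA (h2.1 hxA) h
      have h3 := abs_ncard_sub_lt hα.1 (fun C hC => measurableSet_translates hα.2 hC) hω₀ hsat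
      have h4 := (abs_lt.1 h3).1
      rw [hμ, measureReal_eval ν 1 (hη.2 C C.2)] at h4
      have h5 : {k | w k = C} = {k | X ω₀ k ∈ {z : G → Y | z 1 ∈ (C : Set Y)}} := by
        ext k
        exact (hc _ _).symm
      rw [h5]
      have h6 : ν.real (C : Set Y) - δ ≤
          ({k | X ω₀ k ∈ {z : G → Y | z 1 ∈ (C : Set Y)}}.ncard : ℝ) / d := by linarith
      rw [le_div_iff₀ hd'] at h6
      have h7 : 0 ≤ -Real.log (ν.real (C : Set Y)) := by
        linarith [Real.log_nonpos (measureReal_nonneg (μ := ν) (s := (C : Set Y)))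
          measureReal_le_one]
      have h8 := mul_le_mul_of_nonneg_right h6 h7
      rw [Real.negMulLog]
      linarith
  have hcover : {ω | X ω ∈ pointMaps μ α F δ σ} ⊆
      ⋃ r ∈ (R '' {x | x ∈ pointMaps μ α F δ σ ∧ ∃ ω, X ω = x}).toFinset, {ω | R (X ω) = r} := by
    intro ω hω
    refine Set.mem_biUnion (x := R (X ω)) ?_ rfl
    exact Finset.mem_coe.2 (Set.mem_toFinset.2 ⟨X ω, ⟨hω, ω, rfl⟩, rfl⟩)
  -- Subadditivity suffices here and below, so measurability of these events plays no role.
  have h1 : 1 / 2 ≤ P.real {ω | X ω ∈ pointMaps μ α F δ σ} := by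
    have h2 : (1 : ℝ) ≤ P.real {ω | X ω ∈ pointMaps μ α F δ σ} +
        P.real {ω | X ω ∉ pointMaps μ α F δ σ} := by
      rw [← probReal_univ (μ := P)]
      refine (measureReal_mono fun ω _ => ?_).trans (measureReal_union_le _ _)
      exact em _
    linarith
  have h2 : P.real {ω | X ω ∈ pointMaps μ α F δ σ} ≤ homCard μ ξ α F δ σ * e := by
    refine (measureReal_mono hcover (measure_ne_top P _)).trans
      ((measureReal_biUnion_finset_le _ _).trans ?_)
    refine (Finset.sum_le_card_nsmul _ _ e fun r hr => ?_).trans ?_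
    · obtain ⟨_, ⟨hx, ω₀, rfl⟩, rfl⟩ := Set.mem_toFinset.1 hr
      exact hword ω₀ hx
    · rw [nsmul_eq_mul, homCard_eq hα.1 hξ.1 hαξ hF, ← Set.ncard_eq_toFinset_card']
      refine mul_le_mul_of_nonneg_right ?_ (Real.exp_pos _).le
      have hsub : {x | x ∈ pointMaps μ α F δ σ ∧ ∃ ω, X ω = x} ⊆ pointMaps μ α F δ σ :=
        fun x hx => hx.1
      exact_mod_cast Set.ncard_le_ncard (Set.image_mono hsub) (Set.toFinite _)
  have h3 := h1.trans h2
  rw [he, Real.exp_neg, ← div_eq_mul_inv, le_div_iff₀ (Real.exp_pos _)] at h3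
  linarith

end RandomPoints

/-! ### Index sets of vanishing density -/

section Negligible

/-- The sets `S i` have asymptotically vanishing density. -/
def Negligible {d : ℕ → ℕ} (S : ∀ i, Set (Fin (d i))) : Prop :=
  Tendsto (fun i => ((S i).ncard : ℝ) / (d i : ℝ)) atTop (𝓝 0)

variable {d : ℕ → ℕ}

theorem Negligible.mono {S T : ∀ i, Set (Fin (d i))} (hT : Negligible T) (h : ∀ i, S i ⊆ T i) :
    Negligible S := by
  refine squeeze_zero (fun i => by positivity) (fun i => ?_) hT
  refine div_le_div_of_nonneg_right ?_ (Nat.cast_nonneg _)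
  exact_mod_cast Set.ncard_le_ncard (h i) (Set.toFinite _)

theorem Negligible.union {S T : ∀ i, Set (Fin (d i))} (hS : Negligible S) (hT : Negligible T) :
    Negligible fun i => S i ∪ T i := by
  have h := hS.add hT
  rw [add_zero] at h
  refine squeeze_zero (fun i => by positivity) (fun i => ?_) h
  rw [← add_div]
  refine div_le_div_of_nonneg_right ?_ (Nat.cast_nonneg _)
  exact_mod_cast Set.ncard_union_le _ _

theorem Negligible.biUnion {J : Type*} {s : Finset J} {S : J → ∀ i, Set (Fin (d i))}
    (hS : ∀ j ∈ s, Negligible (S j)) : Negligible fun i => ⋃ j ∈ s, S j i := by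
  have h := tendsto_finsetSum s hS
  rw [Finset.sum_const_zero] at h
  refine squeeze_zero (fun i => by positivity) (fun i => ?_) h
  rw [← Finset.sum_div]
  refine div_le_div_of_nonneg_right ?_ (Nat.cast_nonneg _)
  exact_mod_cast Finset.set_ncard_biUnion_le s fun j => S j i

theorem Negligible.preimage {S : ∀ i, Set (Fin (d i))} (hS : Negligible S)
    (e : ∀ i, Equiv.Perm (Fin (d i))) : Negligible fun i => e i ⁻¹' S i := by
  refine hS.congr fun i => ?_
  rw [← Set.ncard_image_of_injective (e i ⁻¹' S i) (e i).injective,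
    Set.image_preimage_eq _ (e i).surjective]

theorem negligible_compl (hd : ∀ i, 0 < d i) {S : ∀ i, Set (Fin (d i))}
    (hS : Tendsto (fun i => ((S i).ncard : ℝ) / (d i : ℝ)) atTop (𝓝 1)) :
    Negligible fun i => (S i)ᶜ := by
  have h := hS.const_sub 1
  rw [sub_self] at h
  refine h.congr fun i => ?_
  have hd' : (0 : ℝ) < d i := by exact_mod_cast hd i
  have h1 : ((S i).ncard : ℝ) + (S i)ᶜ.ncard = d i := by
    have := Set.ncard_add_ncard_compl (S i)
    rw [Nat.card_eq_fintype_card, Fintype.card_fin] at this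
    exact_mod_cast this
  rw [eq_div_iff hd'.ne', sub_mul, div_mul_cancel₀ _ hd'.ne']
  linarith

end Negligible

/-! ### Soficity and the lower bound -/

section LowerBound

variable {G Y : Type*} [Group G] {d : ℕ → ℕ} {σ : ∀ i, G → Equiv.Perm (Fin (d i))}

/-- Discard the indices where freeness fails on the inverses of `E`, their preimages under `σ s`,
and those where multiplicativity fails for the factorisation `t⁻¹ = (s t)⁻¹ s`. Each is a finite
union of sets of vanishing density. -/
theorem IsSoficApproximation.exists_negligible (hσ : IsSoficApproximation d σ)
    (E E₀ F : Finset G) :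
    ∃ B : ∀ i, Set (Fin (d i)), Negligible B ∧
      (∀ i, ∀ k ∉ B i, Set.InjOn (fun t => σ i t⁻¹ k) (E : Set G)) ∧
      (∀ i, ∀ k ∉ B i, ∀ s ∈ F, Set.InjOn (fun t => σ i t⁻¹ (σ i s k)) (E : Set G)) ∧
      ∀ i, ∀ k ∉ B i, ∀ s ∈ F, ∀ t ∈ E₀, σ i t⁻¹ k = σ i (s * t)⁻¹ (σ i s k) := by
  classical
  set N : ∀ i, Set (Fin (d i)) := fun i => ⋃ p ∈ E.offDiag, {k | σ i p.1⁻¹ k ≠ σ i p.2⁻¹ k}ᶜ with hN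
  set M : ∀ i, Set (Fin (d i)) := fun i => ⋃ p ∈ F ×ˢ E₀,
    {k | σ i ((p.1 * p.2)⁻¹ * p.1) k = σ i (p.1 * p.2)⁻¹ (σ i p.1 k)}ᶜ with hM
  have hNn : Negligible N := Negligible.biUnion fun p hp =>
    negligible_compl hσ.pos (hσ.free _ _ fun h => (Finset.mem_offDiag.1 hp).2.2 (inv_injective h))
  have hMn : Negligible M := Negligible.biUnion fun p _ => negligible_compl hσ.pos (hσ.mult _ _)
  have hinj : ∀ i, ∀ k ∉ N i, Set.InjOn (fun t => σ i t⁻¹ k) (E : Set G) := by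
    intro i k hk t ht t' ht' htt
    by_contra hne
    exact hk (Set.mem_biUnion (x := (t, t')) (Finset.mem_offDiag.2 ⟨ht, ht', hne⟩)
      fun h => h htt)
  refine ⟨fun i => N i ∪ ((⋃ s ∈ F, σ i s ⁻¹' N i) ∪ M i), hNn.union
    ((Negligible.biUnion fun s _ => hNn.preimage fun i => σ i s).union hMn), ?_, ?_, ?_⟩
  · exact fun i k hk => hinj i k fun h => hk (Or.inl h)
  · exact fun i k hk s hs => hinj i _ fun h =>
      hk (Or.inr (Or.inl (Set.mem_biUnion (x := s) hs h)))
  · intro i k hk s hs t ht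
    by_contra hne
    refine hk (Or.inr (Or.inr (Set.mem_biUnion (x := (s, t)) (Finset.mk_mem_product hs ht) ?_)))
    intro h
    apply hne
    have h2 : σ i ((s * t)⁻¹ * s) k = σ i (s * t)⁻¹ (σ i s k) := h
    rw [← h2]
    congr 2
    group

variable [MeasurableSpace Y] (ν : Measure Y) [IsProbabilityMeasure ν]
  {ξ α : Finset (Set (G → Y))} {F : Finset G} {η : Finset (Set Y)}

theorem eventually_exp_le_homCard (hσ : IsSoficApproximation d σ) (hd : Tendsto d atTop atTop)
    (hη : IsFinPartition inferInstance η) (hξ : IsFinPartition inferInstance ξ)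
    (hα : IsFinPartition inferInstance α) (hαξ : Refines α ξ) (hF : 1 ∈ F)
    (hξη : ∀ C ∈ η, {x : G → Y | x 1 ∈ C} ∈ ξ) {δ : ℝ} (hδ : 0 < δ) :
    ∀ᶠ i in atTop, Real.exp (d i * (shannonEntropy ν η - δ * ∑ C ∈ η, -Real.log (ν.real C))) ≤
      2 * homCard (Measure.infinitePi fun _ : G => ν) ξ α F δ (σ i) := by
  classical
  set a : ℝ := F.card * α.card with ha
  have ha0 : 0 ≤ a := by positivity
  -- Makes the limiting failure probability `2 a ε / δ` less than `1/2`; the remaining terms tend to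
  -- zero.
  set ε : ℝ := δ / (8 * (a + 1)) with hε
  have hε0 : 0 < ε := by positivity
  obtain ⟨f, E₀, 𝓑, -, hf⟩ :=
    exists_determinedBy_near_finset (Measure.infinitePi fun _ : G => ν) hα.2 hε0
  -- Equivariance compares coordinate `t` at `k` with coordinate `s t` at `σ s k`, so both must lie
  -- in the shared window.
  set E : Finset G := insert 1 (E₀ ∪ (F ×ˢ E₀).image fun p => p.1 * p.2) with hE
  have hE1 : 1 ∈ E := Finset.mem_insert_self _ _
  have hE₀ : E₀ ⊆ E := fun t ht => Finset.mem_insert_of_mem (Finset.mem_union_left _ ht)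
  have hFE₀ : ∀ s ∈ F, ∀ t ∈ E₀, s * t ∈ E := fun s hs t ht =>
    Finset.mem_insert_of_mem (Finset.mem_union_right _
      (Finset.mem_image.2 ⟨(s, t), Finset.mk_mem_product hs ht, rfl⟩))
  obtain ⟨B, hB, hB1, hB2, hB3⟩ := hσ.exists_negligible E E₀ F
  set n : ℝ := ((translates α F).card : ℝ) with hn
  have hn0 : 0 ≤ n := Nat.cast_nonneg _
  set τ : ℝ := δ / (n + 1) with hτ
  have hτ0 : 0 < τ := by positivity
  have hτδ : n * τ < δ := by
    have h : τ * (n + 1) = δ := div_mul_cancel₀ _ (by positivity)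
    linarith
  have hdinv : Tendsto (fun i => ((d i : ℝ))⁻¹) atTop (𝓝 0) :=
    tendsto_inv_atTop_zero.comp (tendsto_natCast_atTop_atTop.comp hd)
  have hlim : Tendsto (fun i => a * (2 * ε + (B i).ncard / (d i : ℝ)) / δ +
      n * ((2 * ((B i).ncard / (d i : ℝ)) + E.card ^ 2 * ((d i : ℝ))⁻¹) / τ ^ 2)) atTop
      (𝓝 (a * (2 * ε + 0) / δ + n * ((2 * 0 + E.card ^ 2 * 0) / τ ^ 2))) :=
    ((((hB.const_add _).const_mul a).div_const δ)).add
      ((((hB.const_mul 2).add (hdinv.const_mul _)).div_const _).const_mul n)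
  have hlt : a * (2 * ε + 0) / δ + n * ((2 * 0 + E.card ^ 2 * 0) / τ ^ 2) < 1 / 2 := by
    have h : ε * (8 * (a + 1)) = δ := div_mul_cancel₀ _ (by positivity)
    have h2 : a * (2 * ε + 0) / δ < 1 / 2 := by
      rw [div_lt_iff₀ hδ]
      linarith
    simpa using h2
  filter_upwards [hlim.eventually_lt_const hlt] with i hi
  have hd' : (0 : ℝ) < d i := by exact_mod_cast hσ.pos i
  refine exp_le_homCard ν hη hξ hα hαξ hF hξη hE1 (hσ.pos i)
    ((measure_not_pointMaps_le ν hα hε0.le hf hE1 hE₀ hFE₀ (hσ.pos i) (hB1 i) (hB2 i) (hB3 i)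
      hδ hτ0 hτδ).trans (le_trans (le_of_eq ?_) hi.le))
  rw [ha, hn]
  field_simp

theorem shannonEntropy_le_entropyFδ (hσ : IsSoficApproximation d σ) (hd : Tendsto d atTop atTop)
    (hη : IsFinPartition inferInstance η) (hξ : IsFinPartition inferInstance ξ)
    (hα : IsFinPartition inferInstance α) (hαξ : Refines α ξ) (hF : 1 ∈ F)
    (hξη : ∀ C ∈ η, {x : G → Y | x 1 ∈ C} ∈ ξ) {δ : ℝ} (hδ : 0 < δ) :
    (shannonEntropy ν η : EReal) ≤
      entropyFδ d σ (Measure.infinitePi fun _ : G => ν) ξ α F δ := by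
  refine EReal.ge_of_forall_gt_iff_ge.1 fun c hc => le_entropyFδ hσ.pos ?_
  have hc' : c < shannonEntropy ν η := by exact_mod_cast hc
  set M : ℝ := ∑ C ∈ η, -Real.log (ν.real C) with hM
  have hM0 : 0 ≤ M := Finset.sum_nonneg fun C _ => by
    linarith [Real.log_nonpos (measureReal_nonneg (μ := ν) (s := C)) measureReal_le_one]
  set g := shannonEntropy ν η - c with hg
  have hg0 : 0 < g := sub_pos.2 hc'
  -- The given `δ` may be too large for the error `δ M`. A smaller tolerance only lowers the count;
  -- half of `g` pays for `δ' M`, and the other half absorbs the factor two once `d i` is large.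
  set δ' : ℝ := min δ (g / (2 * (M + 1))) with hδ'
  have hδ'0 : 0 < δ' := lt_min hδ (by positivity)
  have hδM : δ' * M ≤ g / 2 := by
    have h1 : δ' ≤ g / (2 * (M + 1)) := min_le_right _ _
    rw [le_div_iff₀ (by positivity)] at h1
    linarith
  have hlarge : ∀ᶠ i in atTop, Real.log 2 / (g / 2) ≤ (d i : ℝ) :=
    (tendsto_natCast_atTop_atTop.comp hd).eventually_ge_atTop _
  filter_upwards [eventually_exp_le_homCard ν hσ hd hη hξ hα hαξ hF hξη hδ'0, hlarge] with i hi hl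
  rw [div_le_iff₀ (by positivity)] at hl
  have h1 : (homCard (Measure.infinitePi fun _ : G => ν) ξ α F δ' (σ i) : ℝ) ≤
      homCard (Measure.infinitePi fun _ : G => ν) ξ α F δ (σ i) := by
    rw [homCard_eq hα.1 hξ.1 hαξ hF, homCard_eq hα.1 hξ.1 hαξ hF]
    exact_mod_cast Set.ncard_le_ncard (Set.image_mono (pointMaps_mono (min_le_left _ _)))
      (Set.toFinite _)
  have h2 : 2 * Real.exp (d i * c) ≤ Real.exp (d i * (shannonEntropy ν η - δ' * M)) := by
    conv_lhs => rw [← Real.exp_log two_pos, ← Real.exp_add]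
    rw [Real.exp_le_exp]
    have h3 : c + g / 2 ≤ shannonEntropy ν η - δ' * M := by linarith
    have h4 := mul_le_mul_of_nonneg_left h3 (Nat.cast_nonneg (α := ℝ) (d i))
    linarith
  linarith

theorem baseEntropy_le (hσ : IsSoficApproximation d σ) (hd : Tendsto d atTop atTop) :
    baseEntropy ν ≤ soficEntropy d σ (Measure.infinitePi fun _ : G => ν) := by
  refine iSup₂_le fun η hη => ?_
  obtain ⟨c, hc⟩ := exists_cell hη.1
  obtain ⟨ξ, hξ, hmem⟩ := exists_fiber_partition MeasurableSpace.pi (fun x : G → Y => c (x 1))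
    fun C => by
      have h : (fun x : G → Y => c (x 1)) ⁻¹' {C} = (fun x => x 1) ⁻¹' (C : Set Y) := by
        ext x
        exact (hc _ _).symm
      rw [h]
      exact measurable_pi_apply 1 (hη.2 C C.2)
  have hξη : ∀ C ∈ η, {x : G → Y | x 1 ∈ C} ∈ ξ := by
    intro C hC
    obtain ⟨y, hy⟩ := Setoid.nonempty_of_mem_partition hη.1 (Finset.mem_coe.2 hC)
    -- A constant configuration shows that the pulled-back cell is a nonempty fibre.
    refine (hmem _).2 ⟨fun _ => y, ?_⟩
    ext x
    have h := (hc y ⟨C, hC⟩).1 hy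
    exact (hc (x 1) ⟨C, hC⟩).trans (by rw [← h]; rfl)
  refine le_iSup₂_of_le ξ hξ ?_
  refine le_iInf₂ fun α hα => le_iInf₂ fun F hF => le_iInf₂ fun δ hδ => ?_
  exact shannonEntropy_le_entropyFδ ν hσ hd hη hξ hα.1 hα.2 hF hξη hδ

end LowerBound

end SoficEntropy

theorem mainTheorem3 {G : Type*} [Group G] [Countable G]
    (d : ℕ → ℕ) (σ : ∀ i, G → Equiv.Perm (Fin (d i)))
    (hσ : SoficEntropy.IsSoficApproximation d σ) (hd : Tendsto d atTop atTop)
    {Y : Type*} [MeasurableSpace Y] (ν : Measure Y) [IsProbabilityMeasure ν] :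
    SoficEntropy.soficEntropy d σ (Measure.infinitePi (fun _ : G => ν)) =
      SoficEntropy.baseEntropy ν :=
  le_antisymm (SoficEntropy.soficEntropy_le ν hσ.pos) (SoficEntropy.baseEntropy_le ν hσ hd)
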